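/- Let $(X,d,\mu)$ be a complete separable metric space with a Borel measure $\mu$ that is finite on balls, and let $p,q\in[1,\infty]$ with $\frac1p+\frac1q=1$. For an absolutely continuous curve $\gamma\colon[0,1]\to X$ let $|\gamma_t'|=\lim_{s\to t}\frac{d(\gamma_s,\gamma_t)}{|s-t|}$ (which exists for a.e. $t$) be its metric speed, and $\int_{\gamma|_{[s,t]}}g\,\mathrm{d}s:=\int_s^tg(\gamma_r)|\gamma_r'|\,\mathrm{d}r$ for Borel $g\colon X\to[0,\infty]$. A \emph{plan} is a finite Borel measure $\eta$ on $C([0,1];X)$ concentrated on absolutely continuous curves. Put $\mathrm{d}\pi:=|\gamma_t'|\,\mathrm{d}t\,\mathrm{d}\eta$, a measure on $[0,1]\times C([0,1];X)$, and let $e(t,\gamma)=\gamma_t$, $e_t(\gamma)=\gamma_t$. The \emph{barycenter} of $\eta$ is the measure $\eta^\#(E)=\int\int_0^1\chi_E(\gamma_t)|\gamma_t'|\,\mathrm{d}t\,\mathrm{d}\eta(\gamma)$, i.e. $\eta^\#=e_*\pi$. A plan $\eta$ is a \emph{$q$-plan} if $\eta^\#=\rho\mu$ for some $\rho\in L^q(\mu)$.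 It is a \emph{$q$-test plan} if there is $C>0$ with $e_{t*}\eta\le C\mu$ for every $t\in[0,1]$, and $\int\int_0^1|\gamma_t'|^q\,\mathrm{d}t\,\mathrm{d}\eta<\infty$ (if $q=\infty$: $\eta$ is concentrated on $L$-Lipschitz curves for some $L$). A \emph{disintegration} of $\pi$ is a Borel family $\{\pi_x\}_{x\in X}$ of probability measures on $[0,1]\times C([0,1];X)$ such that $\pi_x$ is concentrated on $e^{-1}(x)$ for $\eta^\#$-a.e. $x$ and $\int G\,\mathrm{d}\pi=\int_X\int G\,\mathrm{d}\pi_x\,\mathrm{d}\eta^\#(x)$ for every Borel $G\ge0$. $N^{1,p}(X)$ is the set of $f\colon X\to\mathbb R$ in $L^p(\mu)$ that have a $p$-weak upper gradient in $L^p(\mu)$, i.e. a Borel function $g\colon X\to[0,\infty]$, $g\in L^p(\mu)$, such that $|f(\gamma_t)-f(\gamma_s)|\le\int_{\gamma|_{[s,t]}}g\,\mathrm{d}s$ for all $0\le s<t\le1$ and all absolutely continuous $\gamma$ outside a family of zero $p$-modulus. The $p$-modulus of a family $\Gamma$ is the infimum of $\int h^p\,\mathrm{d}\mu$ (of $\|h\|_{L^\infty(\mu)}$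 if $p=\infty$) over Borel $h\colon X\to[0,\infty]$ with $\int_\gamma h\,\mathrm{d}s\ge1$ for all $\gamma\in\Gamma$. \textbf{Proposition.} Let $\eta$ be a $q$-plan on $X$ and $\mathrm{d}\pi=|\gamma_t'|\,\mathrm{d}t\,\mathrm{d}\eta$. Then there exists a $q$-test plan $\bar\eta$ on $X$ such that $$\eta^\#\ll\bar\eta^\#\ll\eta^\#,$$ the measures $\pi$ and $\mathrm{d}\bar\pi:=|\gamma_t'|\,\mathrm{d}t\,\mathrm{d}\bar\eta$ admit disintegrations, and for any disintegrations $\{\pi_x\}$ of $\pi$ and $\{\bar\pi_x\}$ of $\bar\pi$ and every $f\in N^{1,p}(X)$, $$\left\|\frac{(f\circ\gamma)_t'}{|\gamma_t'|}\right\|_{L^\infty(\pi_x)}=\left\|\frac{(f\circ\gamma)_t'}{|\gamma_t'|}\right\|_{L^\infty(\bar\pi_x)}\qquad\text{for }\eta^\#\text{-a.e. }x\in X.$$ -/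

import Mathlib

open MeasureTheory ProbabilityTheory Filter Topology Set unitInterval
open scoped ENNReal NNReal

noncomputable section

namespace CurvePlans

/-- `C([0,1];X)`, with the topology of uniform convergence, carries its Borel sigma-algebra. -/
instance instMeasurableSpaceCurves {X : Type*} [TopologicalSpace X] : MeasurableSpace C(I, X) :=
  borel _

instance instBorelSpaceCurves {X : Type*} [TopologicalSpace X] : BorelSpace C(I, X) := ⟨rfl⟩

/-- The evaluation map `e(t, γ) = γ_t`. -/
def evalCurve {X : Type*} [TopologicalSpace X] (z : I × C(I, X)) : X := z.2 z.1

/-- `γ ∈ AC([0,1];X)`. Mathlib's notion of absolute continuity is for functions on `ℝ` restricted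
to an interval, so `γ` is extended to `ℝ` by its end values; only its values on `[0,1]` matter. -/
def IsACCurve {X : Type*} [MetricSpace X] (γ : C(I, X)) : Prop :=
  AbsolutelyContinuousOnInterval (IccExtend (zero_le_one' ℝ) γ) 0 1

/-- The metric speed `|γ_t'|`, the limit of `d(γ_s, γ_t) / |s - t|` as `s → t`, `s ≠ t`. It exists
for almost every `t` if `γ` is absolutely continuous; the upper limit makes it total. -/
def metricSpeed {X : Type*} [MetricSpace X] (γ : C(I, X)) (t : I) : ℝ≥0∞ :=
  limsup (fun s : I => edist (γ s) (γ t) / edist s t) (𝓝[≠] t)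

/-- The line integral of `g` over the restriction of `γ` to `[s,t]`. -/
def curveIntegral {X : Type*} [MetricSpace X] (g : X → ℝ≥0∞) (γ : C(I, X)) (s t : I) : ℝ≥0∞ :=
  ∫⁻ r in Icc s t, g (γ r) * metricSpeed γ r

/-! ### Modulus, weak upper gradients, Newton-Sobolev functions -/

/-- The `p`-modulus of a family `Γ` of absolutely continuous curves: the infimum, over the
nonnegative Borel functions `g` whose integral over each curve of `Γ` is at least one, of
`∫ g^p dμ` (of the essential supremum of `g` if `p = ∞`). -/
def curveModulus {X : Type*} [MetricSpace X] [MeasurableSpace X] (p : ℝ≥0∞) (μ : Measure X)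
    (Γ : Set C(I, X)) : ℝ≥0∞ :=
  ⨅ (g : X → ℝ≥0∞) (_ : Measurable g) (_ : ∀ γ ∈ Γ, 1 ≤ curveIntegral g γ 0 1),
    if p = ∞ then essSup g μ else ∫⁻ x, g x ^ p.toReal ∂μ

/-- `g` is a `p`-weak upper gradient of `f`: the upper gradient inequality on all subintervals
holds for all absolutely continuous curves outside a family of zero `p`-modulus. -/
def IsWeakUpperGradient {X : Type*} [MetricSpace X] [MeasurableSpace X] (p : ℝ≥0∞) (μ : Measure X)
    (f : X → ℝ) (g : X → ℝ≥0∞) : Prop :=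
  Measurable g ∧
    curveModulus p μ {γ : C(I, X) | IsACCurve γ ∧
      ¬ ∀ s t : I, s ≤ t → edist (f (γ t)) (f (γ s)) ≤ curveIntegral g γ s t} = 0

/-- `f ∈ N^{1,p}(X)`: `f` is in `L^p(μ)` and has a `p`-weak upper gradient in `L^p(μ)`. -/
def MemNewtonSobolev {X : Type*} [MetricSpace X] [MeasurableSpace X] (p : ℝ≥0∞) (μ : Measure X)
    (f : X → ℝ) : Prop :=
  MemLp f p μ ∧ ∃ g : X → ℝ≥0∞, IsWeakUpperGradient p μ f g ∧ eLpNorm g p μ < ∞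

/-! ### Plans -/

/-- A plan: a finite measure on `C([0,1];X)` concentrated on absolutely continuous curves. -/
structure IsPlan {X : Type*} [MetricSpace X] (η : Measure C(I, X)) : Prop where
  finite : IsFiniteMeasure η
  ae_ac : ∀ᵐ γ ∂η, IsACCurve γ

/-- The measure `dπ = |γ_t'| dt dη` on `[0,1] × C([0,1];X)`. -/
def speedMeasure {X : Type*} [MetricSpace X] (η : Measure C(I, X)) : Measure (I × C(I, X)) :=
  ((volume : Measure I).prod η).withDensity fun z => metricSpeed z.2 z.1

/-- The barycenter `η^#(E) = ∫ ∫_0^1 χ_E(γ_t) |γ_t'| dt dη(γ)`, that is, the image of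
`|γ_t'| dt dη` under the evaluation map. -/
def barycenter {X : Type*} [MetricSpace X] [MeasurableSpace X] (η : Measure C(I, X)) : Measure X :=
  (speedMeasure η).map evalCurve

/-- A `q`-plan: a plan whose barycenter has a density in `L^q(μ)`. -/
structure IsQPlan {X : Type*} [MetricSpace X] [MeasurableSpace X] (q : ℝ≥0∞) (μ : Measure X)
    (η : Measure C(I, X)) : Prop where
  isPlan : IsPlan η
  density : ∃ ρ : X → ℝ≥0∞, Measurable ρ ∧ eLpNorm ρ q μ < ∞ ∧ barycenter η = μ.withDensity ρ

/-- A `q`-test plan: a plan with finite `q`-energy (concentrated on `L`-Lipschitz curves for some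
`L` if `q = ∞`) and with `e_{t*} η ≤ C μ` for all `t`, with `C` independent of `t`. -/
structure IsQTestPlan {X : Type*} [MetricSpace X] [MeasurableSpace X] (q : ℝ≥0∞) (μ : Measure X)
    (η : Measure C(I, X)) : Prop where
  isPlan : IsPlan η
  energy : q ≠ ∞ → ∫⁻ γ, (∫⁻ t : I, metricSpeed γ t ^ q.toReal) ∂η < ∞
  lipschitz : q = ∞ → ∃ L : ℝ≥0, ∀ᵐ γ : C(I, X) ∂η, LipschitzWith L γ
  compression : ∃ C : ℝ≥0, 0 < C ∧ ∀ t : I, η.map (fun γ : C(I, X) => γ t) ≤ C • μ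

/-! ### Disintegration and normalized derivatives -/

/-- The Borel family `κ` of probability measures is a disintegration of `π` with respect to `φ`:
`κ y` is concentrated on `φ⁻¹(y)` for almost every `y`, and `∫ G dπ = ∫ ∫ G dκ_y d(φ_* π)(y)`. -/
structure IsDisintegration {Z Y : Type*} [MeasurableSpace Z] [MeasurableSpace Y] (φ : Z → Y)
    (π : Measure Z) (κ : Kernel Y Z) : Prop where
  prob : IsMarkovKernel κ
  concentrated : ∀ᵐ y ∂(π.map φ), ∀ᵐ z ∂(κ y), φ z = y
  lintegral_eq : ∀ G : Z → ℝ≥0∞, Measurable G →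
    ∫⁻ z, G z ∂π = ∫⁻ y, ∫⁻ z, G z ∂(κ y) ∂(π.map φ)

/-- The function `(t, γ) ↦ (f ∘ γ)_t' / |γ_t'|`. For `f ∈ N^{1,p}(X)` and a `q`-plan `η`, with
`p`, `q` dual exponents, the derivative exists and the speed is positive and finite at almost every
`(t, γ)` with respect to `|γ_t'| dt dη`. -/
def normalizedDeriv {X : Type*} [MetricSpace X] (f : X → ℝ) (z : I × C(I, X)) : ℝ :=
  derivWithin (IccExtend (zero_le_one' ℝ) (f ∘ z.2)) (Icc 0 1) (z.1 : ℝ) /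
    (metricSpeed z.2 z.1).toReal

end CurvePlans

end

set_option linter.unusedSectionVars false

namespace CurvePlans

/-! ### Primitives of functions on the unit interval -/

/-! The normalized derivative `(f ∘ γ)' / |γ'|` does not depend on the parametrization, so the plan
may be altered by reweighting, reparametrizing and cutting its curves, provided that the same points
of the same curves stay visible up to null sets.

Let `ρ` be an everywhere finite density of the barycenter, bounded if `q = ∞`, and put `h = 1 /
max(1, ρ)`. Parametrize each curve proportionally to its `h`-length `T = ∫ h(γ)|γ'| dt`; the new
speed is `T / h = T max(1, ρ)` (`metricSpeed_reparam`). The integral of `g` over the new time is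
`T⁻¹ ∫ g(γ) h(γ) |γ'| dt` (`lintegral_reparam`). If the plan is reweighted by `c = min(1, T) ≤ T`,
the factor `T⁻¹` is absorbed, and since `h ρ ≤ 1` the time average of the image measures is at most
`μ`.

This bounds only the average over time. To bound every single time, the curve is replaced by a
random subcurve occupying a fraction `a ≤ 1/2` of the time, with uniform position. Its point at a
fixed time `t` is then uniformly distributed over a time interval of length `1 - a ≥ 1/2` of the
whole curve, which costs a factor `2` (`lintegral_eval_resampledPlan_le`). With `a T ≤ 1` the speed
of the subcurves is at most `max(1, ρ)`, and the compression bound turns this into a bound of the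
`q`-energy by the mass plus `2 ∫ ρ^q dμ`, or into a Lipschitz bound if `q = ∞`
(`isQTestPlan_resampledPlan`).

Null sets for both plans are described by one and the same condition on the pairs (time,
reparametrized curve): for the original plan because reparametrization maps `h(γ)|γ'| dt` to a
multiple of Lebesgue measure (`speedMeasure_eq_zero_iff_reparam`), for the new one because the
subcurves of one curve cover it (`speedMeasure_resampledPlan_eq_zero_iff`). Hence the superlevel
sets of the normalized derivative, cut by preimages of Borel sets of `X`, are null simultaneously,
and this forces equal essential suprema on almost every fibre of any disintegrations
(`ae_eLpNorm_top_eq`).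

It remains to see that the normalized derivative is almost everywhere measurable
(`aemeasurable_normalizedDeriv`). By duality of modulus and `q`-plans, `f ∘ γ` is continuous for
almost every `γ`, so it is determined by its values at countably many times, where `f` may be
replaced by a Borel representative. -/

/-- The primitive `r ↦ ∫_0^r w` of a function `w` on the unit interval. -/
noncomputable def primitive (w : I → ℝ≥0∞) (r : I) : ℝ := (∫⁻ x in Iic r, w x).toReal

/-- Almost every statement on `[0,1]` follows from the statement on the real line. -/
lemma ae_unitInterval_of_ae {P : ℝ → Prop} (h : ∀ᵐ x : ℝ, x ∈ Icc (0 : ℝ) 1 → P x) :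
    ∀ᵐ t : I, P t := by
  have h2 : ∀ᵐ x ∂(volume.restrict I), P x := (ae_restrict_iff' measurableSet_Icc).2 h
  exact unitInterval.measurePreserving_coe.quasiMeasurePreserving.ae h2

lemma ae_unitInterval_mem_Ioo : ∀ᵐ t : I, (t : ℝ) ∈ Ioo (0 : ℝ) 1 := by
  apply ae_unitInterval_of_ae
  have h₁ : ∀ᵐ x : ℝ, x ≠ 0 := by simp [ae_iff, measure_singleton]
  have h₂ : ∀ᵐ x : ℝ, x ≠ 1 := by simp [ae_iff, measure_singleton]
  filter_upwards [h₁, h₂] with x h1 h2 hx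
  exact ⟨lt_of_le_of_ne hx.1 (Ne.symm h1), lt_of_le_of_ne hx.2 h2⟩

lemma setLIntegral_unitInterval (f : ℝ → ℝ≥0∞) (s : Set ℝ) :
    ∫⁻ t in ((↑) : I → ℝ) ⁻¹' s, f t = ∫⁻ x in s ∩ Icc 0 1, f x := by
  rw [unitInterval.measurePreserving_coe.setLIntegral_comp_preimage_emb
    unitInterval.measurableEmbedding_coe, Measure.restrict_restrict' measurableSet_Icc]

lemma map_coe_nhdsNE (t : I) :
    map ((↑) : I → ℝ) (𝓝[≠] t) = 𝓝[Icc (0 : ℝ) 1 \ {(t : ℝ)}] (t : ℝ) := by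
  rw [Topology.IsEmbedding.subtypeVal.map_nhdsWithin_eq]
  congr 1
  ext x
  simp only [mem_image, mem_compl_iff, mem_singleton_iff, Subtype.exists, Set.mem_sdiff]
  constructor
  · rintro ⟨a, ha, h, rfl⟩
    exact ⟨ha, fun h' => h (Subtype.ext h')⟩
  · rintro ⟨hx, h⟩
    exact ⟨x, hx, fun h' => h (congrArg Subtype.val h'), rfl⟩

/-- One-sided differentiability on `[0,1]` in terms of difference quotients on `[0,1]`. -/
lemma hasDerivWithinAt_IccExtend_iff {φ : I → ℝ} {c : ℝ} {t : I} :
    HasDerivWithinAt (IccExtend (zero_le_one' ℝ) φ) c (Icc 0 1) (t : ℝ) ↔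
      Tendsto (fun s : I => (φ s - φ t) / ((s : ℝ) - t)) (𝓝[≠] t) (𝓝 c) := by
  rw [hasDerivWithinAt_iff_tendsto_slope, ← map_coe_nhdsNE, tendsto_map'_iff]
  refine tendsto_congr fun s => ?_
  simp [slope_def_field, IccExtend_val]

lemma setLIntegral_IccExtend (w : I → ℝ≥0∞) (s : Set ℝ) :
    ∫⁻ t in ((↑) : I → ℝ) ⁻¹' s, w t =
      ∫⁻ x in s ∩ Icc 0 1, IccExtend (zero_le_one' ℝ) w x := by
  rw [← setLIntegral_unitInterval]
  simp

variable {w : I → ℝ≥0∞}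

lemma lintegral_IccExtend (w : I → ℝ≥0∞) :
    ∫⁻ t, w t = ∫⁻ x in Icc 0 1, IccExtend (zero_le_one' ℝ) w x := by
  simpa using setLIntegral_IccExtend w univ

lemma intervalIntegrable_IccExtend (hw : Measurable w) (hfin : ∫⁻ t, w t ≠ ∞) :
    IntervalIntegrable (fun x => (IccExtend (zero_le_one' ℝ) w x).toReal) volume 0 1 := by
  rw [intervalIntegrable_iff_integrableOn_Icc_of_le zero_le_one]
  rw [lintegral_IccExtend] at hfin
  exact integrable_toReal_of_lintegral_ne_top
    (hw.comp continuous_projIcc.measurable).aemeasurable hfin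

lemma primitive_eq_intervalIntegral (hw : Measurable w) (hfin : ∫⁻ t, w t ≠ ∞) (r : I) :
    primitive w r = ∫ x in (0 : ℝ)..r, (IccExtend (zero_le_one' ℝ) w x).toReal := by
  have h1 : Iic r = ((↑) : I → ℝ) ⁻¹' (Iic (r : ℝ)) := by ext; simp
  have h2 : Iic (r : ℝ) ∩ Icc 0 1 = Icc 0 (r : ℝ) := by
    ext x
    simp only [mem_inter_iff, mem_Iic, mem_Icc]
    exact ⟨fun h => ⟨h.2.1, h.1⟩, fun h => ⟨h.2, h.1, h.2.trans r.2.2⟩⟩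
  have hmeas : Measurable (IccExtend (zero_le_one' ℝ) w) := hw.comp continuous_projIcc.measurable
  rw [intervalIntegral.integral_of_le r.2.1, ← integral_Icc_eq_integral_Ioc, integral_toReal,
    primitive, h1, setLIntegral_IccExtend, h2]
  · exact hmeas.aemeasurable
  · rw [lintegral_IccExtend] at hfin
    exact ae_restrict_of_ae_restrict_of_subset (Icc_subset_Icc_right r.2.2)
      (ae_lt_top hmeas hfin)

lemma continuous_primitive (hw : Measurable w) (hfin : ∫⁻ t, w t ≠ ∞) :
    Continuous (primitive w) := by
  have h := (intervalIntegral.continuousOn_primitive_interval' (intervalIntegrable_IccExtend hw hfin)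
    (left_mem_uIcc (a := (0 : ℝ)) (b := 1)))
  rw [uIcc_of_le zero_le_one] at h
  have h2 := continuousOn_iff_continuous_domRestrict.1 h
  convert h2 using 1
  ext r
  exact primitive_eq_intervalIntegral hw hfin r

lemma ofReal_primitive (hfin : ∫⁻ t, w t ≠ ∞) (r : I) :
    ENNReal.ofReal (primitive w r) = ∫⁻ x in Iic r, w x :=
  ENNReal.ofReal_toReal (ne_top_of_le_ne_top hfin (setLIntegral_le_lintegral _ _))

lemma primitive_nonneg (r : I) : 0 ≤ primitive w r := ENNReal.toReal_nonneg

lemma monotone_primitive (hfin : ∫⁻ t, w t ≠ ∞) : Monotone (primitive w) := fun _ _ h =>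
  ENNReal.toReal_mono (ne_top_of_le_ne_top hfin (setLIntegral_le_lintegral _ _))
    (lintegral_mono_set (Iic_subset_Iic.2 h))

lemma ofReal_primitive_sub (hfin : ∫⁻ t, w t ≠ ∞) {s t : I} (hst : s ≤ t) :
    ENNReal.ofReal (primitive w t - primitive w s) = ∫⁻ x in Icc s t, w x := by
  rw [ENNReal.ofReal_sub _ (primitive_nonneg s), ofReal_primitive hfin, ofReal_primitive hfin]
  have hfin' : ∫⁻ x in Iic s, w x ≠ ∞ :=
    ne_top_of_le_ne_top hfin (setLIntegral_le_lintegral _ _)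
  rw [← Iic_union_Ioc_eq_Iic hst, lintegral_union measurableSet_Ioc
    (Iic_disjoint_Ioc le_rfl), ENNReal.add_sub_cancel_left hfin']
  exact setLIntegral_congr Ioc_ae_eq_Icc

lemma tendsto_slope_primitive (hw : Measurable w) (hfin : ∫⁻ t, w t ≠ ∞) :
    ∀ᵐ t : I, Tendsto (fun s : I => (primitive w s - primitive w t) / ((s : ℝ) - t)) (𝓝[≠] t)
      (𝓝 (w t).toReal) := by
  have h := (intervalIntegrable_IccExtend hw hfin).ae_hasDerivAt_integral
  rw [uIcc_of_le zero_le_one] at h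
  filter_upwards [ae_unitInterval_of_ae h] with t ht
  have h1 := (ht 0 (left_mem_Icc.2 zero_le_one)).hasDerivWithinAt (s := Icc 0 1)
  rw [IccExtend_val] at h1
  rw [← hasDerivWithinAt_IccExtend_iff]
  refine h1.congr (fun x hx => ?_) ?_
  · rw [IccExtend_of_mem _ _ hx, primitive_eq_intervalIntegral hw hfin]
  · rw [IccExtend_val, primitive_eq_intervalIntegral hw hfin]

variable {X : Type*} [MetricSpace X]

/-- A curve whose increments are bounded by those of a primitive is absolutely continuous. -/
lemma isACCurve_of_dist_le {γ : C(I, X)} (hw : Measurable w) (hfin : ∫⁻ t, w t ≠ ∞)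
    (h : ∀ s t, dist (γ s) (γ t) ≤ |primitive w t - primitive w s|) : IsACCurve γ := by
  have hac := (intervalIntegrable_IccExtend hw hfin).absolutelyContinuousOnInterval_intervalIntegral
    (left_mem_uIcc (a := (0 : ℝ)) (b := 1))
  refine squeeze_zero' (Eventually.of_forall fun E => Finset.sum_nonneg fun i _ => dist_nonneg)
    ?_ hac
  filter_upwards [mem_inf_of_right (mem_principal_self _)] with E hE
  refine Finset.sum_le_sum fun i hi => ?_
  obtain ⟨h1, h2⟩ := hE.1 i hi
  rw [uIcc_of_le zero_le_one] at h1 h2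
  have e1 := primitive_eq_intervalIntegral hw hfin ⟨_, h1⟩
  have e2 := primitive_eq_intervalIntegral hw hfin ⟨_, h2⟩
  rw [IccExtend_of_mem _ _ h1, IccExtend_of_mem _ _ h2, dist_comm (∫ x in _.._, _), Real.dist_eq]
  simp only at e1 e2
  rw [← e1, ← e2]
  exact h _ _

/-! ### The metric speed -/

variable {X : Type*} [MetricSpace X]

lemma continuous_evalCurve {X : Type*} [TopologicalSpace X] :
    Continuous (evalCurve : I × C(I, X) → X) :=
  ContinuousEval.continuous_eval.comp continuous_swap

lemma edist_unitInterval_pos {s t : I} (h : s ≠ t) : edist s t ≠ 0 := by simpa using h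

lemma edist_div_edist_eq_ofReal (γ : C(I, X)) {s t : I} (h : s ≠ t) :
    edist (γ s) (γ t) / edist s t = ENNReal.ofReal (dist (γ s) (γ t) / |(s : ℝ) - t|) := by
  have h' : 0 < dist s t := dist_pos.2 h
  rw [edist_dist, edist_dist, ← ENNReal.ofReal_div_of_pos h']
  rfl

/-- The upper limit is an infimum over radii `1/(n+1)` of suprema of difference quotients over
punctured balls. Each supremum is lower semicontinuous jointly in time and curve: its superlevel
sets are projections of open sets, once the quotient inequality is written without division. -/
lemma measurable_metricSpeed [SecondCountableTopology X] :
    Measurable fun z : I × C(I, X) => metricSpeed z.2 z.1 := by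
  have hb : ∀ z : I × C(I, X), metricSpeed z.2 z.1 =
      ⨅ n : ℕ, ⨆ s ∈ Metric.ball z.1 (1 / ((n : ℝ) + 1)) ∩ {z.1}ᶜ,
        edist (z.2 s) (z.2 z.1) / edist s z.1 := fun z => by
    have := (nhdsWithin_hasBasis (Metric.nhds_basis_ball_inv_nat_succ (x := z.1))
      {z.1}ᶜ).limsup_eq_iInf_iSup (u := fun s : I => edist (z.2 s) (z.2 z.1) / edist s z.1)
    simpa [metricSpeed] using this
  simp_rw [hb]
  refine Measurable.iInf fun n => LowerSemicontinuous.measurable ?_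
  rw [lowerSemicontinuous_iff_isOpen_preimage]
  intro c
  rcases eq_or_ne c ∞ with rfl | hc
  · simp
  have : (fun z : I × C(I, X) => ⨆ s ∈ Metric.ball z.1 (1 / ((n : ℝ) + 1)) ∩ {z.1}ᶜ,
      edist (z.2 s) (z.2 z.1) / edist s z.1) ⁻¹' Ioi c =
      Prod.snd '' {y : I × (I × C(I, X)) | dist y.1 y.2.1 < 1 / ((n : ℝ) + 1) ∧ y.1 ≠ y.2.1 ∧
        c * edist y.1 y.2.1 < edist (y.2.2 y.1) (y.2.2 y.2.1)} := by
    ext z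
    simp only [mem_preimage, mem_Ioi, lt_iSup_iff, mem_image, Set.mem_ofPred_eq, Prod.exists]
    constructor
    · rintro ⟨s, ⟨h1, h2⟩, h3⟩
      refine ⟨s, z.1, z.2, ⟨h1, h2, ?_⟩, rfl⟩
      exact (ENNReal.lt_div_iff_mul_lt (Or.inl (edist_unitInterval_pos h2))
        (Or.inl (edist_ne_top _ _))).1 h3
    · rintro ⟨s, t, γ, ⟨h1, h2, h3⟩, rfl⟩
      exact ⟨s, ⟨h1, h2⟩, (ENNReal.lt_div_iff_mul_lt (Or.inl (edist_unitInterval_pos h2))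
        (Or.inl (edist_ne_top _ _))).2 h3⟩
  rw [this]
  refine isOpenMap_snd _ ?_
  have e1 : Continuous fun y : I × (I × C(I, X)) => y.2.2 y.1 := by fun_prop
  have e2 : Continuous fun y : I × (I × C(I, X)) => y.2.2 y.2.1 := by fun_prop
  have e3 : Continuous fun y : I × (I × C(I, X)) => y.1 := continuous_fst
  have e4 : Continuous fun y : I × (I × C(I, X)) => y.2.1 := by fun_prop
  exact (isOpen_lt (e3.dist e4) continuous_const).inter ((isOpen_ne_fun e3 e4).inter
    (isOpen_lt ((ENNReal.continuous_const_mul hc).comp (e3.edist e4)) (e1.edist e2)))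

lemma measurable_metricSpeed_curve [SecondCountableTopology X] (γ : C(I, X)) :
    Measurable (metricSpeed γ) := by
  have h : Measurable fun t : I => (t, γ) := measurable_prodMk_right
  simpa [Function.comp_def] using measurable_metricSpeed.comp h

/-- A bound for the metric speed by the derivative of a function that bounds the increments. -/
lemma metricSpeed_le_of_tendsto {γ : C(I, X)} {V : I → ℝ} {t : I} {c : ℝ}
    (hV : ∀ s, dist (γ s) (γ t) ≤ |V s - V t|)
    (h : Tendsto (fun s : I => (V s - V t) / ((s : ℝ) - t)) (𝓝[≠] t) (𝓝 c)) :
    metricSpeed γ t ≤ ENNReal.ofReal |c| := by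
  have h1 := (ENNReal.continuous_ofReal.tendsto _).comp h.abs
  rw [← h1.limsup_eq]
  refine limsup_le_limsup ?_
  filter_upwards [self_mem_nhdsWithin] with s hs
  rw [edist_div_edist_eq_ofReal γ hs]
  simp only [Function.comp_apply, abs_div]
  gcongr
  exact hV s

/-- A bound from below for the metric speed. -/
lemma le_metricSpeed_of_tendsto {γ : C(I, X)} {V : I → ℝ} {t : I} {c : ℝ}
    (hV : ∀ s, |V s - V t| ≤ dist (γ s) (γ t))
    (h : Tendsto (fun s : I => (V s - V t) / ((s : ℝ) - t)) (𝓝[≠] t) (𝓝 c)) :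
    ENNReal.ofReal |c| ≤ metricSpeed γ t := by
  unfold metricSpeed
  have h1 := (ENNReal.continuous_ofReal.tendsto _).comp h.abs
  rw [← h1.limsup_eq]
  refine limsup_le_limsup ?_
  filter_upwards [self_mem_nhdsWithin] with s hs
  rw [edist_div_edist_eq_ofReal γ hs]
  simp only [Function.comp_apply, abs_div]
  gcongr
  exact hV s

variable [SecondCountableTopology X]

/-- An isometric embedding into a normed space gives bounded variation. The variation function is
monotone and dominates the increments of the curve, so its derivative, which is integrable,
dominates the metric speed almost everywhere. -/
lemma IsACCurve.lintegral_metricSpeed_lt_top {γ : C(I, X)} (hγ : IsACCurve γ) :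
    ∫⁻ t, metricSpeed γ t < ∞ := by
  have hiso := kuratowskiEmbedding.isometry X
  have hac : AbsolutelyContinuousOnInterval
      (kuratowskiEmbedding X ∘ IccExtend (zero_le_one' ℝ) γ) 0 1 := by
    simpa only [IsACCurve, AbsolutelyContinuousOnInterval, Function.comp_apply, hiso.dist_eq]
      using hγ
  have hbv := hac.boundedVariationOn
  rw [uIcc_of_le zero_le_one] at hbv
  have hlbv := hbv.locallyBoundedVariationOn
  set g := kuratowskiEmbedding X ∘ IccExtend (zero_le_one' ℝ) γ
  set V : ℝ → ℝ := variationOnFromTo g (Icc 0 1) 0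
  have h0 : (0 : ℝ) ∈ Icc (0 : ℝ) 1 := left_mem_Icc.2 zero_le_one
  have hmono : MonotoneOn V (Icc 0 1) := variationOnFromTo.monotoneOn hlbv h0
  have hle : ∀ s t : I, s ≤ t → dist (γ s) (γ t) ≤ V t - V s := by
    intro s t hst
    rw [variationOnFromTo.sub_right hlbv h0 t.2 s.2, variationOnFromTo.eq_of_le _ _ (show (s : ℝ) ≤ t from hst)]
    have h1 : edist (g s) (g t) ≤ eVariationOn g (Icc 0 1 ∩ Icc (s : ℝ) t) :=
      eVariationOn.edist_le _ ⟨s.2, le_rfl, hst⟩ ⟨t.2, hst, le_rfl⟩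
    have h2 := ENNReal.toReal_mono (hlbv s t s.2 t.2) h1
    simpa [g, IccExtend_val, edist_dist, hiso.dist_eq] using h2
  have hle' : ∀ s t : I, dist (γ s) (γ t) ≤ |V s - V t| := by
    intro s t
    rcases le_total s t with h | h
    · rw [abs_sub_comm]
      exact (hle s t h).trans (le_abs_self _)
    · rw [dist_comm]
      exact (hle t s h).trans (le_abs_self _)
  have hbound : ∀ᵐ t : I, metricSpeed γ t ≤ ‖deriv V t‖ₑ := by
    have hd : ∀ᵐ t : I, DifferentiableWithinAt ℝ V (Icc 0 1) t :=
      ae_unitInterval_of_ae hmono.ae_differentiableWithinAt_of_mem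
    filter_upwards [hd, ae_unitInterval_mem_Ioo] with t ht ht'
    have h1 : HasDerivWithinAt V (deriv V t) (Icc 0 1) t :=
      (ht.differentiableAt (Icc_mem_nhds ht'.1 ht'.2)).hasDerivAt.hasDerivWithinAt
    have h2 : HasDerivWithinAt (IccExtend (zero_le_one' ℝ) fun s : I => V s)
        (deriv V t) (Icc 0 1) t :=
      h1.congr (fun x hx => by rw [IccExtend_of_mem _ _ hx]) (by rw [IccExtend_val])
    rw [Real.enorm_eq_ofReal_abs]
    exact metricSpeed_le_of_tendsto (fun s => hle' s t) (hasDerivWithinAt_IccExtend_iff.1 h2)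
  refine (lintegral_mono_ae hbound).trans_lt ?_
  have h3 := setLIntegral_unitInterval (fun x => ‖deriv V x‖ₑ) univ
  simp only [preimage_univ, univ_inter, Measure.restrict_univ] at h3
  rw [h3]
  have h4 : IntervalIntegrable (deriv V) volume 0 1 :=
    MonotoneOn.intervalIntegrable_deriv (by rwa [uIcc_of_le zero_le_one])
  rw [intervalIntegrable_iff_integrableOn_Icc_of_le zero_le_one] at h4
  exact h4.2

/-- The distance to the fixed point `γ s` is 1-Lipschitz, so along the curve it is an absolutely
continuous real function whose derivative is bounded by the metric speed; the fundamental theorem of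
calculus applies to it. -/
lemma IsACCurve.edist_le {γ : C(I, X)} (hγ : IsACCurve γ) {s t : I} (hst : s ≤ t) :
    edist (γ s) (γ t) ≤ ∫⁻ r in Icc s t, metricSpeed γ r := by
  set g := IccExtend (zero_le_one' ℝ) γ with hg
  set φ : ℝ → ℝ := fun x => dist (g x) (γ s) with hφ
  have hac : AbsolutelyContinuousOnInterval φ 0 1 := by
    refine squeeze_zero (fun E => Finset.sum_nonneg fun i _ => dist_nonneg) (fun E => ?_) hγ
    exact Finset.sum_le_sum fun i _ => dist_dist_dist_le_left _ _ _
  have hac' : AbsolutelyContinuousOnInterval φ s t := by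
    refine hac.mono ?_
    rw [uIcc_of_le zero_le_one, uIcc_of_le (show (s : ℝ) ≤ t from hst)]
    exact Icc_subset_Icc s.2.1 t.2.2
  have hd := hac.ae_differentiableAt
  rw [uIcc_of_le zero_le_one] at hd
  have hbound : ∀ᵐ r : I, ‖deriv φ r‖ₑ ≤ metricSpeed γ r := by
    filter_upwards [ae_unitInterval_of_ae hd] with r hr
    have h1 : HasDerivWithinAt (IccExtend (zero_le_one' ℝ) fun s' : I => dist (γ s') (γ s))
      (deriv φ r) (Icc 0 1) r := hr.hasDerivAt.hasDerivWithinAt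
    rw [Real.enorm_eq_ofReal_abs]
    exact le_metricSpeed_of_tendsto (fun s' => abs_dist_sub_le _ _ _)
      (hasDerivWithinAt_IccExtend_iff.1 h1)
  have h1 : dist (γ s) (γ t) = ∫ x in (s : ℝ)..t, deriv φ x := by
    rw [hac'.integral_deriv_eq_sub]
    simp [hφ, hg, IccExtend_val, dist_comm]
  have h2 : ((↑) : I → ℝ) ⁻¹' Icc (s : ℝ) t = Icc s t := by ext; simp
  have h3 : Icc (s : ℝ) t ∩ Icc 0 1 = Icc (s : ℝ) t :=
    inter_eq_left.2 (Icc_subset_Icc s.2.1 t.2.2)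
  calc edist (γ s) (γ t) = ‖∫ x in Icc (s : ℝ) t, deriv φ x‖ₑ := by
        rw [integral_Icc_eq_integral_Ioc, ← intervalIntegral.integral_of_le hst, ← h1, edist_dist,
          Real.enorm_eq_ofReal dist_nonneg]
    _ ≤ ∫⁻ x in Icc (s : ℝ) t, ‖deriv φ x‖ₑ := enorm_integral_le_lintegral_enorm _
    _ = ∫⁻ r in Icc s t, ‖deriv φ (r : I)‖ₑ := by
        rw [← h2, setLIntegral_unitInterval (fun x => ‖deriv φ x‖ₑ), h3]
    _ ≤ _ := lintegral_mono_ae (ae_restrict_of_ae hbound)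

/-- Continuity of `u` is not assumed: besides curves, this serves for `f ∘ γ`, whose continuity is
deduced from the bound. -/
lemma dist_le_primitive {Y : Type*} [PseudoMetricSpace Y] {u : I → Y} {w : I → ℝ≥0∞} (hfin : ∫⁻ t, w t ≠ ∞)
    (h : ∀ s t : I, s ≤ t → edist (u s) (u t) ≤ ∫⁻ r in Icc s t, w r) (s t : I) :
    dist (u s) (u t) ≤ |primitive w t - primitive w s| := by
  wlog hst : s ≤ t generalizing s t
  · rw [dist_comm, abs_sub_comm]
    exact this t s (le_of_not_ge hst)
  have h1 := h s t hst
  rw [← ofReal_primitive_sub hfin hst, edist_dist] at h1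
  have h2 := sub_nonneg.2 (monotone_primitive hfin hst)
  rw [abs_of_nonneg h2]
  exact (ENNReal.ofReal_le_ofReal_iff h2).1 h1

lemma IsACCurve.dist_le {γ : C(I, X)} (hγ : IsACCurve γ) (s t : I) :
    dist (γ s) (γ t) ≤ |primitive (metricSpeed γ) t - primitive (metricSpeed γ) s| :=
  dist_le_primitive hγ.lintegral_metricSpeed_lt_top.ne (fun _ _ h => hγ.edist_le h) s t

lemma isACCurve_of_edist_le {γ : C(I, X)} {w : I → ℝ≥0∞} (hw : Measurable w)
    (hfin : ∫⁻ t, w t ≠ ∞)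
    (h : ∀ s t : I, s ≤ t → edist (γ s) (γ t) ≤ ∫⁻ r in Icc s t, w r) : IsACCurve γ :=
  isACCurve_of_dist_le hw hfin (dist_le_primitive hfin h)

/-- By continuity of the curve and of the primitive of its speed, the increment bound need only be
tested at a countable dense set of times. This makes the set of absolutely continuous curves Borel.
-/
lemma isACCurve_iff (γ : C(I, X)) :
    IsACCurve γ ↔ ∫⁻ t, metricSpeed γ t < ∞ ∧ ∀ n m : ℕ,
      dist (γ (TopologicalSpace.denseSeq I n)) (γ (TopologicalSpace.denseSeq I m)) ≤
        |primitive (metricSpeed γ) (TopologicalSpace.denseSeq I m) -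
          primitive (metricSpeed γ) (TopologicalSpace.denseSeq I n)| := by
  refine ⟨fun h => ⟨h.lintegral_metricSpeed_lt_top, fun n m => h.dist_le _ _⟩, fun ⟨h1, h2⟩ => ?_⟩
  have hm := measurable_metricSpeed_curve γ
  have hc := continuous_primitive hm h1.ne
  refine isACCurve_of_dist_le hm h1.ne fun s t => ?_
  have hcl : IsClosed {z : I × I | dist (γ z.1) (γ z.2) ≤
      |primitive (metricSpeed γ) z.2 - primitive (metricSpeed γ) z.1|} :=
    isClosed_le (by fun_prop) (by fun_prop)
  have hd := (TopologicalSpace.denseRange_denseSeq I).prodMap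
    (TopologicalSpace.denseRange_denseSeq I)
  exact hd.induction_on (p := fun z : I × I => dist (γ z.1) (γ z.2) ≤
    |primitive (metricSpeed γ) z.2 - primitive (metricSpeed γ) z.1|) (s, t) hcl fun z => h2 z.1 z.2

lemma measurable_primitive_param {Ω : Type*} [MeasurableSpace Ω] {w : Ω → I → ℝ≥0∞}
    (hw : Measurable fun z : Ω × I => w z.1 z.2) :
    Measurable fun z : Ω × I => primitive (w z.1) z.2 := by
  refine ENNReal.measurable_toReal.comp ?_
  have : (fun z : Ω × I => ∫⁻ x in Iic z.2, w z.1 x) =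
      fun z : Ω × I => ∫⁻ x, {y : (Ω × I) × I | y.2 ≤ y.1.2}.indicator
        (fun y => w y.1.1 y.2) (z, x) := by
    ext z
    rw [← lintegral_indicator measurableSet_Iic]
    rfl
  rw [this]
  refine Measurable.lintegral_prod_right' (f := {y : (Ω × I) × I | y.2 ≤ y.1.2}.indicator
        (fun y => w y.1.1 y.2)) ?_
  refine Measurable.indicator ?_ (measurableSet_le measurable_snd measurable_fst.snd)
  exact hw.comp (measurable_fst.fst.prodMk measurable_snd)

lemma measurableSet_isACCurve :
    MeasurableSet {γ : C(I, X) | IsACCurve γ} := by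
  simp_rw [isACCurve_iff, Set.ofPred_and, Set.ofPred_forall]
  have hs : Measurable fun z : C(I, X) × I => metricSpeed z.1 z.2 := by
    have h : Measurable fun z : C(I, X) × I => (z.2, z.1) := measurable_swap
    simpa [Function.comp_def] using measurable_metricSpeed.comp h
  have hp := measurable_primitive_param hs
  refine (measurableSet_lt hs.lintegral_prod_right' measurable_const).inter
    (MeasurableSet.iInter fun n => MeasurableSet.iInter fun m => measurableSet_le ?_ ?_)
  · exact Continuous.measurable (by fun_prop)
  · have := (hp.comp (measurable_prodMk_right (y := TopologicalSpace.denseSeq I m))).sub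
      (hp.comp (measurable_prodMk_right (y := TopologicalSpace.denseSeq I n)))
    exact this.abs

/-! ### Measurability of maps into spaces of curves -/

/-- A map into a space of curves is measurable if its evaluations are. -/
lemma measurable_curve_of_eval {Ω Y : Type*} [MeasurableSpace Ω] [PseudoMetricSpace Y]
    [SecondCountableTopology Y] [MeasurableSpace Y] [BorelSpace Y] {F : Ω → C(I, Y)}
    (h : ∀ t, Measurable fun ω => F ω t) : Measurable F := by
  have hbasis : TopologicalSpace.IsTopologicalBasis
      {U : Set C(I, Y) | ∃ c r, U = Metric.ball c r} := by
    refine TopologicalSpace.isTopologicalBasis_of_isOpen_of_nhds ?_ fun c U hc hU => ?_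
    · rintro _ ⟨c, r, rfl⟩
      exact Metric.isOpen_ball
    · obtain ⟨r, hr, hrU⟩ := Metric.isOpen_iff.1 hU c hc
      exact ⟨_, ⟨c, r, rfl⟩, Metric.mem_ball_self hr, hrU⟩
  have hgen : (instMeasurableSpaceCurves : MeasurableSpace C(I, Y)) =
      MeasurableSpace.generateFrom {U : Set C(I, Y) | ∃ c r, U = Metric.ball c r} :=
    hbasis.borel_eq_generateFrom
  rw [hgen]
  refine measurable_generateFrom ?_
  rintro _ ⟨c, r, rfl⟩
  have hd : Measurable fun ω => dist (F ω) c := by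
    refine measurable_of_Iic fun a => ?_
    rcases lt_or_ge a 0 with ha | ha
    · convert MeasurableSet.empty
      ext ω
      simpa using ha.trans_le dist_nonneg
    · have : (fun ω => dist (F ω) c) ⁻¹' Iic a = ⋂ n : ℕ,
          {ω | dist (F ω (TopologicalSpace.denseSeq I n)) (c (TopologicalSpace.denseSeq I n)) ≤
            a} := by
        ext ω
        simp only [mem_preimage, mem_Iic, mem_iInter, Set.mem_ofPred_eq, ContinuousMap.dist_le ha]
        refine ⟨fun h n => h _, fun h t => ?_⟩
        exact (TopologicalSpace.denseRange_denseSeq I).induction_on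
          (p := fun t => dist (F ω t) (c t) ≤ a) t
          (isClosed_le ((F ω).continuous.dist c.continuous) continuous_const) h
      rw [this]
      exact MeasurableSet.iInter fun n => measurableSet_le ((h _).dist measurable_const)
        measurable_const
  exact hd measurableSet_Iio

/-! ### Change of parameter -/

section ChangeOfParameter

variable {X : Type*} [MetricSpace X] {γ₁ γ₂ : C(I, X)} {α : I → I} {t : I} {κ : ℝ}

/-- The metric speed of a reparametrized curve. -/
lemma metricSpeed_comp (h : ∀ s, γ₂ s = γ₁ (α s)) (hκ : 0 < κ)
    (hmap : map α (𝓝[≠] t) = 𝓝[≠] (α t))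
    (hs : Tendsto (fun s => ((α s : ℝ) - α t) / ((s : ℝ) - t)) (𝓝[≠] t) (𝓝 κ)) :
    metricSpeed γ₂ t = ENNReal.ofReal κ * metricSpeed γ₁ (α t) := by
  have hne : ∀ᶠ s in 𝓝[≠] t, α s ≠ α t := by
    have : ∀ᶠ u in map α (𝓝[≠] t), u ≠ α t := by
      rw [hmap]
      exact self_mem_nhdsWithin
    exact this
  set G : I → ℝ≥0∞ := fun s => edist (γ₁ (α s)) (γ₁ (α t)) / edist (α s) (α t)
  set F : I → ℝ≥0∞ := fun s => edist (γ₂ s) (γ₂ t) / edist s t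
  set u : I → ℝ≥0∞ := fun s => edist (α s) (α t) / edist s t
  have hG : metricSpeed γ₁ (α t) = limsup G (𝓝[≠] t) := by
    unfold metricSpeed
    rw [← hmap]
    rfl
  have hu : Tendsto u (𝓝[≠] t) (𝓝 (ENNReal.ofReal κ)) := by
    have h1 := (ENNReal.continuous_ofReal.tendsto _).comp hs.abs
    rw [abs_of_pos hκ] at h1
    refine h1.congr' ?_
    filter_upwards [self_mem_nhdsWithin] with s hs
    have h' : 0 < dist s t := dist_pos.2 hs
    simp only [u, edist_dist, ← ENNReal.ofReal_div_of_pos h', Function.comp_apply, abs_div]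
    rfl
  have hu' : Tendsto (fun s => (u s)⁻¹) (𝓝[≠] t) (𝓝 (ENNReal.ofReal κ)⁻¹) := hu.inv
  have hpos : ENNReal.ofReal κ ≠ 0 := by simpa using hκ
  have hF : F =ᶠ[𝓝[≠] t] u * G := by
    filter_upwards [hne, self_mem_nhdsWithin] with s h1 h2
    have h3 := edist_unitInterval_pos h1
    simp only [F, u, G, Pi.mul_apply, h]
    rw [mul_comm, ← mul_div_assoc, ENNReal.div_mul_cancel h3 (edist_ne_top _ _)]
  have hG' : G =ᶠ[𝓝[≠] t] (fun s => (u s)⁻¹) * F := by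
    filter_upwards [hne, self_mem_nhdsWithin, hF] with s h1 h2 h3
    have h4 : u s ≠ 0 := ENNReal.div_ne_zero.2 ⟨edist_unitInterval_pos h1, edist_ne_top _ _⟩
    have h5 : u s ≠ ∞ := ENNReal.div_ne_top (edist_ne_top _ _) (edist_unitInterval_pos h2)
    rw [Pi.mul_apply, h3, Pi.mul_apply, ← mul_assoc, ENNReal.inv_mul_cancel h4 h5, one_mul]
  rw [hG]
  change limsup F _ = _
  -- The factor `u` converges to a positive finite limit, so each inequality is the product bound
  -- for upper limits, applied to `F = u G` and to `G = u⁻¹ F`.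
  apply le_antisymm
  · rw [limsup_congr hF]
    refine (ENNReal.limsup_mul_le' ?_ ?_).trans_eq (by rw [hu.limsup_eq])
    · exact Or.inl (by rwa [hu.limsup_eq])
    · exact Or.inl (by rw [hu.limsup_eq]; exact ENNReal.ofReal_ne_top)
  · rw [limsup_congr hG', mul_comm, ← ENNReal.le_div_iff_mul_le (Or.inl hpos)
      (Or.inl ENNReal.ofReal_ne_top), ENNReal.div_eq_inv_mul]
    refine (ENNReal.limsup_mul_le' ?_ ?_).trans_eq (by rw [hu'.limsup_eq])
    · exact Or.inl (by rw [hu'.limsup_eq]; simp)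
    · exact Or.inl (by rw [hu'.limsup_eq]; simpa using hκ)

lemma hasDerivWithinAt_comp_iff {φ₁ φ₂ : I → ℝ} (h : ∀ s, φ₂ s = φ₁ (α s)) (hκ : 0 < κ)
    (hmap : map α (𝓝[≠] t) = 𝓝[≠] (α t))
    (hs : Tendsto (fun s => ((α s : ℝ) - α t) / ((s : ℝ) - t)) (𝓝[≠] t) (𝓝 κ)) (c : ℝ) :
    HasDerivWithinAt (IccExtend (zero_le_one' ℝ) φ₂) (κ * c) (Icc 0 1) (t : ℝ) ↔
      HasDerivWithinAt (IccExtend (zero_le_one' ℝ) φ₁) c (Icc 0 1) (α t : ℝ) := by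
  have hne : ∀ᶠ s in 𝓝[≠] t, α s ≠ α t := by
    have : ∀ᶠ u in map α (𝓝[≠] t), u ≠ α t := by
      rw [hmap]
      exact self_mem_nhdsWithin
    exact this
  rw [hasDerivWithinAt_IccExtend_iff, hasDerivWithinAt_IccExtend_iff, ← hmap, tendsto_map'_iff]
  have key : ∀ᶠ s in 𝓝[≠] t, (φ₂ s - φ₂ t) / ((s : ℝ) - t) =
      ((α s : ℝ) - α t) / ((s : ℝ) - t) * ((φ₁ (α s) - φ₁ (α t)) / ((α s : ℝ) - α t)) := by
    filter_upwards [hne, self_mem_nhdsWithin] with s h1 h2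
    have h1' : (α s : ℝ) - α t ≠ 0 := sub_ne_zero.2 fun h' => h1 (Subtype.ext h')
    rw [h, h]
    field_simp
  have key' : ∀ᶠ s in 𝓝[≠] t, (φ₁ (α s) - φ₁ (α t)) / ((α s : ℝ) - α t) =
      (((α s : ℝ) - α t) / ((s : ℝ) - t))⁻¹ * ((φ₂ s - φ₂ t) / ((s : ℝ) - t)) := by
    filter_upwards [hne, self_mem_nhdsWithin] with s h1 h2
    have h1' : (α s : ℝ) - α t ≠ 0 := sub_ne_zero.2 fun h' => h1 (Subtype.ext h')
    have h2' : (s : ℝ) - t ≠ 0 := sub_ne_zero.2 fun h' => h2 (Subtype.ext h')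
    rw [h, h]
    field_simp
  constructor
  · intro h1
    have h2 := (hs.inv₀ hκ.ne').mul h1
    rw [inv_mul_cancel_left₀ hκ.ne'] at h2
    exact h2.congr' (key'.mono fun s hs => hs.symm)
  · intro h1
    exact (hs.mul h1).congr' (key.mono fun s hs => hs.symm)

/-- Differentiability is not needed: it holds on both sides or on neither, and in the latter case
both derivatives have the default value `0`. -/
lemma derivWithin_comp_eq {φ₁ φ₂ : I → ℝ} (h : ∀ s, φ₂ s = φ₁ (α s)) (hκ : 0 < κ)
    (hmap : map α (𝓝[≠] t) = 𝓝[≠] (α t))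
    (hs : Tendsto (fun s => ((α s : ℝ) - α t) / ((s : ℝ) - t)) (𝓝[≠] t) (𝓝 κ)) :
    derivWithin (IccExtend (zero_le_one' ℝ) φ₂) (Icc 0 1) (t : ℝ) =
      κ * derivWithin (IccExtend (zero_le_one' ℝ) φ₁) (Icc 0 1) (α t : ℝ) := by
  have hu : ∀ s : I, UniqueDiffWithinAt ℝ (Icc (0 : ℝ) 1) s := fun s =>
    uniqueDiffOn_Icc zero_lt_one s s.2
  have iff := hasDerivWithinAt_comp_iff h hκ hmap hs
  by_cases hd : DifferentiableWithinAt ℝ (IccExtend (zero_le_one' ℝ) φ₁) (Icc 0 1) (α t : ℝ)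
  · exact ((iff _).2 hd.hasDerivWithinAt).derivWithin (hu t)
  · have hd' : ¬ DifferentiableWithinAt ℝ (IccExtend (zero_le_one' ℝ) φ₂) (Icc 0 1) (t : ℝ) := by
      intro h2
      refine hd ((iff (κ⁻¹ * derivWithin (IccExtend (zero_le_one' ℝ) φ₂) (Icc 0 1) (t : ℝ))).1
        ?_).differentiableWithinAt
      rw [mul_inv_cancel_left₀ hκ.ne']
      exact h2.hasDerivWithinAt
    rw [derivWithin_zero_of_not_differentiableWithinAt hd,
      derivWithin_zero_of_not_differentiableWithinAt hd', mul_zero]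

/-- The normalized derivative does not depend on the parametrization. -/
lemma normalizedDeriv_comp (f : X → ℝ) (h : ∀ s, γ₂ s = γ₁ (α s)) (hκ : 0 < κ)
    (hmap : map α (𝓝[≠] t) = 𝓝[≠] (α t))
    (hs : Tendsto (fun s => ((α s : ℝ) - α t) / ((s : ℝ) - t)) (𝓝[≠] t) (𝓝 κ)) :
    normalizedDeriv f (t, γ₂) = normalizedDeriv f (α t, γ₁) := by
  unfold normalizedDeriv
  simp only
  rw [metricSpeed_comp h hκ hmap hs, derivWithin_comp_eq (φ₁ := f ∘ γ₁) (φ₂ := f ∘ γ₂)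
    (fun s => by simp [h]) hκ hmap hs, ENNReal.toReal_mul, ENNReal.toReal_ofReal hκ.le,
    mul_div_mul_left _ _ hκ.ne']

end ChangeOfParameter

/-! ### Reparametrization by a normalized primitive -/

section NormalizedPrimitive

variable {w : I → ℝ≥0∞}

/-- The primitive of a function on `[0,1]`, normalized to have the value `1` at `1`. -/
noncomputable def normalizedPrimitive (w : I → ℝ≥0∞) (r : I) : I :=
  projIcc 0 1 zero_le_one (primitive w r / primitive w 1)

lemma primitive_one : primitive w 1 = (∫⁻ t, w t).toReal := by
  have : Iic (1 : I) = univ := eq_univ_of_forall fun r => r.2.2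
  rw [primitive, this, Measure.restrict_univ]

lemma primitive_one_pos (hfin : ∫⁻ t, w t ≠ ∞) (hpos : ∫⁻ t, w t ≠ 0) : 0 < primitive w 1 := by
  rw [primitive_one]
  exact ENNReal.toReal_pos hpos hfin

lemma coe_normalizedPrimitive (hfin : ∫⁻ t, w t ≠ ∞) (r : I) :
    (normalizedPrimitive w r : ℝ) = primitive w r / primitive w 1 := by
  have h : primitive w r / primitive w 1 ∈ Icc (0 : ℝ) 1 :=
    ⟨div_nonneg (primitive_nonneg r) (primitive_nonneg 1),
      div_le_one_of_le₀ (monotone_primitive hfin r.2.2) (primitive_nonneg 1)⟩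
  rw [normalizedPrimitive, projIcc_of_mem zero_le_one h]

lemma continuous_normalizedPrimitive (hw : Measurable w) (hfin : ∫⁻ t, w t ≠ ∞) :
    Continuous (normalizedPrimitive w) :=
  continuous_projIcc.comp ((continuous_primitive hw hfin).div_const _)

lemma monotone_normalizedPrimitive (hfin : ∫⁻ t, w t ≠ ∞) : Monotone (normalizedPrimitive w) :=
  fun _ _ h => monotone_projIcc _
    (div_le_div_of_nonneg_right (monotone_primitive hfin h) (primitive_nonneg 1))

lemma normalizedPrimitive_zero (hfin : ∫⁻ t, w t ≠ ∞) : normalizedPrimitive w 0 = 0 := by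
  ext
  have : primitive w 0 = 0 := by
    have : Iic (0 : I) = {0} := by
      ext r
      simp
    rw [primitive, this]
    simp
  rw [coe_normalizedPrimitive hfin, this, zero_div]
  rfl

lemma normalizedPrimitive_one (hfin : ∫⁻ t, w t ≠ ∞) (hpos : ∫⁻ t, w t ≠ 0) :
    normalizedPrimitive w 1 = 1 := by
  ext
  rw [coe_normalizedPrimitive hfin, div_self (primitive_one_pos hfin hpos).ne']
  rfl

lemma surjective_normalizedPrimitive (hw : Measurable w) (hfin : ∫⁻ t, w t ≠ ∞)
    (hpos : ∫⁻ t, w t ≠ 0) : Function.Surjective (normalizedPrimitive w) := by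
  intro u
  have h := intermediate_value_Icc (zero_le_one' I)
    (continuous_normalizedPrimitive hw hfin).continuousOn
  rw [normalizedPrimitive_zero hfin, normalizedPrimitive_one hfin hpos] at h
  obtain ⟨r, -, hr⟩ := h ⟨u.2.1, u.2.2⟩
  exact ⟨r, hr⟩

/-- This replaces the change of variables formula. The normalized primitive may be constant on
intervals, but these carry no mass of `w dt`. -/
lemma map_normalizedPrimitive (hw : Measurable w) (hfin : ∫⁻ t, w t ≠ ∞)
    (hpos : ∫⁻ t, w t ≠ 0) :
    ((volume : Measure I).withDensity w).map (normalizedPrimitive w) =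
      (∫⁻ t, w t) • (volume : Measure I) := by
  have hc := continuous_normalizedPrimitive hw hfin
  have : IsFiniteMeasure ((volume : Measure I).withDensity w) :=
    isFiniteMeasure_withDensity hfin
  refine Measure.ext_of_Iic _ _ fun u => ?_
  -- By monotonicity the compact preimage of `Iic u` is `Iic r` for its greatest element `r`, and
  -- `r` is mapped to `u` itself by surjectivity.
  obtain ⟨r, hr, hmax⟩ := (isClosed_Iic.preimage hc : IsClosed
    (normalizedPrimitive w ⁻¹' Iic u)).isCompact.exists_isGreatest
    ⟨0, by simp [normalizedPrimitive_zero hfin]⟩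
  have hru : normalizedPrimitive w r = u := by
    obtain ⟨r', hr'⟩ := surjective_normalizedPrimitive hw hfin hpos u
    refine le_antisymm hr ?_
    rw [← hr']
    exact monotone_normalizedPrimitive hfin (hmax hr'.le)
  have hset : normalizedPrimitive w ⁻¹' Iic u = Iic r := by
    ext r'
    exact ⟨fun h => hmax h, fun h => (monotone_normalizedPrimitive hfin h).trans hr⟩
  rw [Measure.map_apply hc.measurable measurableSet_Iic, hset,
    withDensity_apply _ measurableSet_Iic, Measure.smul_apply, unitInterval.volume_Iic, ← hru,
    coe_normalizedPrimitive hfin, ENNReal.ofReal_div_of_pos (primitive_one_pos hfin hpos),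
    ofReal_primitive hfin, primitive_one, ENNReal.ofReal_toReal hfin, smul_eq_mul,
    ENNReal.mul_div_cancel hpos hfin]

lemma lintegral_comp_normalizedPrimitive (hw : Measurable w) (hfin : ∫⁻ t, w t ≠ ∞)
    (hpos : ∫⁻ t, w t ≠ 0) {Φ : I → ℝ≥0∞} (hΦ : Measurable Φ) :
    ∫⁻ r, w r * Φ (normalizedPrimitive w r) = (∫⁻ t, w t) * ∫⁻ v, Φ v := by
  have hm := (continuous_normalizedPrimitive hw hfin).measurable
  rw [← smul_eq_mul, ← lintegral_smul_measure, ← map_normalizedPrimitive hw hfin hpos, lintegral_map hΦ hm,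
    lintegral_withDensity_eq_lintegral_mul (g := fun r => Φ (normalizedPrimitive w r)) _ hw
      (hΦ.comp hm)]
  rfl

/-- Where the density is positive, the normalized primitive is a local change of parameter. -/
lemma normalizedPrimitive_local (hw : Measurable w) (hfin : ∫⁻ t, w t ≠ ∞)
    (hpos : ∫⁻ t, w t ≠ 0) {r : I}
    (hr : Tendsto (fun s : I => (primitive w s - primitive w r) / ((s : ℝ) - r)) (𝓝[≠] r)
      (𝓝 (w r).toReal)) (hr' : w r ≠ ∞) (hr0 : w r ≠ 0) :
    0 < (w r).toReal / primitive w 1 ∧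
      map (normalizedPrimitive w) (𝓝[≠] r) = 𝓝[≠] (normalizedPrimitive w r) ∧
      Tendsto (fun s => ((normalizedPrimitive w s : ℝ) - normalizedPrimitive w r) / ((s : ℝ) - r))
        (𝓝[≠] r) (𝓝 ((w r).toReal / primitive w 1)) := by
  have hone := primitive_one_pos hfin hpos
  have hκ : 0 < (w r).toReal / primitive w 1 := div_pos (ENNReal.toReal_pos hr0 hr') hone
  have hslope : Tendsto (fun s => ((normalizedPrimitive w s : ℝ) - normalizedPrimitive w r) /
      ((s : ℝ) - r)) (𝓝[≠] r) (𝓝 ((w r).toReal / primitive w 1)) := by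
    refine (hr.div_const (primitive w 1)).congr fun s => ?_
    rw [coe_normalizedPrimitive hfin, coe_normalizedPrimitive hfin]
    ring
  refine ⟨hκ, ?_, hslope⟩
  have hc := continuous_normalizedPrimitive hw hfin
  have hsurj := surjective_normalizedPrimitive hw hfin hpos
  have hmono := monotone_normalizedPrimitive hfin
  have hne : ∀ᶠ s in 𝓝[≠] r, normalizedPrimitive w s ≠ normalizedPrimitive w r := by
    filter_upwards [hslope.eventually (lt_mem_nhds hκ)] with s hs heq
    rw [heq, sub_self, zero_div] at hs
    exact lt_irrefl _ hs
  -- A second point of the fibre would make the monotone function constant on an interval ending at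
  -- `r`, against the positive slope there.
  have hfib : ∀ s, normalizedPrimitive w s = normalizedPrimitive w r → s = r := by
    intro s hs
    by_contra hsr
    rcases lt_or_gt_of_ne hsr with hlt | hlt
    · have := nhdsLT_neBot_of_exists_lt ⟨s, hlt⟩
      have h1 : ∀ᶠ s' in 𝓝[<] r, normalizedPrimitive w s' ≠ normalizedPrimitive w r :=
        hne.filter_mono (nhdsWithin_mono r fun x (hx : x < r) => hx.ne)
      obtain ⟨s', h2, h3⟩ := (h1.and (Ioo_mem_nhdsLT hlt)).exists
      exact h2 (le_antisymm (hmono h3.2.le) (hs ▸ hmono h3.1.le))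
    · have := nhdsGT_neBot_of_exists_gt ⟨s, hlt⟩
      have h1 : ∀ᶠ s' in 𝓝[>] r, normalizedPrimitive w s' ≠ normalizedPrimitive w r :=
        hne.filter_mono (nhdsWithin_mono r fun x (hx : r < x) => hx.ne')
      obtain ⟨s', h2, h3⟩ := (h1.and (Ioo_mem_nhdsGT hlt)).exists
      exact h2 (le_antisymm (hs ▸ hmono h3.2.le) (hmono h3.1.le))
  -- A continuous map of a compact space to a Hausdorff space is closed, so neighbourhoods of a
  -- value pull back to a basis of neighbourhoods of its fibre, here a single point.
  have hcomap : comap (normalizedPrimitive w) (𝓝[≠] (normalizedPrimitive w r)) = 𝓝[≠] r := by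
    have h1 : comap (normalizedPrimitive w) (𝓝 (normalizedPrimitive w r)) = 𝓝 r := by
      have h2 := hc.isClosedMap.comap_nhds_eq hc (normalizedPrimitive w r)
      have h3 : normalizedPrimitive w ⁻¹' {normalizedPrimitive w r} = {r} := by
        ext s
        exact ⟨fun h => hfib s h, fun h => by rw [mem_singleton_iff.1 h]; rfl⟩
      rw [h2, h3, nhdsSet_singleton]
    rw [nhdsWithin, comap_inf, h1, comap_principal, nhdsWithin]
    congr 2
    ext s
    simp only [preimage_compl, mem_compl_iff, mem_preimage, mem_singleton_iff]
    exact not_congr ⟨hfib s, fun h => by rw [h]⟩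
  rw [← hcomap, map_comap_of_surjective hsurj]

end NormalizedPrimitive

/-! ### Affine subcurves -/

/-- Needed to conclude that a set of full measure in `[0,1]` is dense. -/
instance : (volume : Measure I).IsOpenPosMeasure := by
  refine ⟨fun U hU ⟨t, ht⟩ hU0 => ?_⟩
  obtain ⟨b, c, -, hbc, hsub⟩ := exists_Icc_mem_subset_of_mem_nhds (hU.mem_nhds ht)
  have h1 := measure_mono_null hsub hU0
  rw [unitInterval.volume_Icc, ENNReal.ofReal_eq_zero, sub_nonpos] at h1
  obtain ⟨u, hu, hut⟩ := ((eventually_nhdsWithin_of_eventually_nhds (s := {t}ᶜ) hbc).and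
    self_mem_nhdsWithin).exists
  have ht' := mem_of_mem_nhds hbc
  exact hut (le_antisymm (hu.2.trans (le_trans h1 ht'.1)) (ht'.2.trans (le_trans h1 hu.1)))

section Affine

/-- The affine map of `[0,1]` onto the subinterval `[(1 - a) s, (1 - a) s + a]`. -/
def subinterval (a s t : I) : I :=
  ⟨(1 - a) * s + a * t, by
    have h1 := a.2.1
    have h2 := a.2.2
    have := mul_le_mul_of_nonneg_left s.2.2 (sub_nonneg.2 h2)
    have := mul_le_mul_of_nonneg_left t.2.2 h1
    exact ⟨add_nonneg (mul_nonneg (sub_nonneg.2 h2) s.2.1) (mul_nonneg h1 t.2.1), by linarith⟩⟩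

@[simp] lemma coe_subinterval (a s t : I) : (subinterval a s t : ℝ) = (1 - a) * s + a * t := rfl

lemma continuous_subinterval : Continuous fun z : I × I × I => subinterval z.1 z.2.1 z.2.2 :=
  Continuous.subtype_mk (by fun_prop) _

lemma continuous_subinterval_right (a s : I) : Continuous (subinterval a s) :=
  continuous_subinterval.comp (by fun_prop : Continuous fun t : I => (a, s, t))

/-- Position and time play symmetric roles: at a fixed time, averaging over the position of the
subinterval is an average over an interval of length `1 - a`. -/
lemma subinterval_symm (a s t : I) : subinterval (σ a) t s = subinterval a s t := by
  ext
  simp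
  ring

@[simp] lemma subinterval_one (s t : I) : subinterval 1 s t = t := by
  ext
  simp

lemma lintegral_subinterval (a s : I) (ha : 0 < a) (Φ : I → ℝ≥0∞) :
    ENNReal.ofReal a * ∫⁻ t, Φ (subinterval a s t) =
      ∫⁻ v in ((↑) : I → ℝ) ⁻¹' Icc ((1 - a) * s) ((1 - a) * s + a), Φ v := by
  have ha' : (0 : ℝ) < a := ha
  have hsub : Icc ((1 - a : ℝ) * s) ((1 - a) * s + a) ⊆ Icc 0 1 := by
    have h2 := a.2.2
    have := mul_le_mul_of_nonneg_left s.2.2 (sub_nonneg.2 h2)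
    have := mul_nonneg (sub_nonneg.2 h2) s.2.1
    exact Icc_subset_Icc this (by linarith)
  have himg : (fun x : ℝ => (a : ℝ) * x + (1 - a) * s) '' Icc 0 1 =
      Icc ((1 - a : ℝ) * s) ((1 - a) * s + a) := by
    rw [image_affine_Icc' ha']
    congr 1 <;> ring
  rw [setLIntegral_IccExtend, inter_eq_left.2 hsub, ← himg,
    lintegral_image_eq_lintegral_abs_deriv_mul (f' := fun _ => (a : ℝ)) measurableSet_Icc
      (fun x _ => by
        simpa using (((hasDerivAt_id x).const_mul (a : ℝ)).add_const
          ((1 - a : ℝ) * s)).hasDerivWithinAt (s := Icc 0 1))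
      (fun x _ y _ h => by simpa [ha'.ne'] using h), lintegral_IccExtend,
    ← lintegral_const_mul' _ _ ENNReal.ofReal_ne_top, abs_of_pos ha']
  refine setLIntegral_congr_fun measurableSet_Icc fun x hx => ?_
  have h1 : (a : ℝ) * x + (1 - a) * s ∈ Icc (0 : ℝ) 1 := by
    refine hsub ?_
    rw [← himg]
    exact mem_image_of_mem _ hx
  simp only [IccExtend_of_mem _ _ hx, IccExtend_of_mem _ _ h1]
  congr 2
  ext
  simp
  ring

lemma lintegral_subinterval_le (a s : I) (ha : 0 < a) (Φ : I → ℝ≥0∞) :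
    ENNReal.ofReal a * ∫⁻ t, Φ (subinterval a s t) ≤ ∫⁻ v, Φ v := by
  rw [lintegral_subinterval a s ha]
  exact setLIntegral_le_lintegral _ _

lemma ae_subinterval {a : I} (ha : 0 < a) (s : I) {P : I → Prop} (h : ∀ᵐ v, P v) :
    ∀ᵐ t, P (subinterval a s t) := by
  obtain ⟨N, hN, hNm, hN0⟩ := exists_measurable_superset_of_null (ae_iff.1 h)
  have h1 := lintegral_subinterval_le a s ha (N.indicator 1)
  rw [lintegral_indicator_one hNm, hN0, nonpos_iff_eq_zero, mul_eq_zero] at h1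
  have h2 : ∫⁻ t, N.indicator 1 (subinterval a s t) = (0 : ℝ≥0∞) :=
    h1.resolve_left (by simpa using ha)
  have hm : Measurable fun t => N.indicator (1 : I → ℝ≥0∞) (subinterval a s t) :=
    (measurable_one.indicator hNm).comp (continuous_subinterval_right a s).measurable
  rw [lintegral_eq_zero_iff hm] at h2
  filter_upwards [h2] with t ht
  by_contra hP
  have : subinterval a s t ∈ N := hN hP
  simp [this] at ht

/-- The good positions `s` are dense, so every interior `v` lies in the interior of a subinterval
with good position. The exceptional set is null in that subinterval, and a locally null set is null.
-/
lemma ae_of_ae_subinterval {a : I} (ha : 0 < a) {P : I → Prop} (hP : MeasurableSet {v | P v})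
    (h : ∀ᵐ s, ∀ᵐ t, P (subinterval a s t)) : ∀ᵐ v, P v := by
  have ha' : (0 : ℝ) < a := ha
  have hdense := Measure.dense_of_ae h
  have key : volume {v : I | (v : ℝ) ∈ Ioo (0 : ℝ) 1 ∧ ¬ P v} = 0 := by
    refine measure_null_of_locally_null _ fun v hv => ?_
    have hopen : IsOpen {s : I | (1 - a : ℝ) * s < v ∧ (v : ℝ) < (1 - a) * s + a} :=
      (isOpen_lt (f := fun s : I => (1 - a : ℝ) * s) (g := fun _ => (v : ℝ)) (by fun_prop)
        (by fun_prop)).inter (isOpen_lt (f := fun _ : I => (v : ℝ))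
          (g := fun s : I => (1 - a : ℝ) * s + a) (by fun_prop) (by fun_prop))
    obtain ⟨s, hs1, hs2⟩ := hdense.inter_open_nonempty _ hopen
      ⟨v, by nlinarith [hv.1.1], by nlinarith [hv.1.2]⟩
    refine ⟨(((↑) : I → ℝ) ⁻¹' Icc ((1 - a) * s) ((1 - a) * s + a)) ∩ {v | ¬ P v}, ?_, ?_⟩
    · refine inter_mem (mem_nhdsWithin_of_mem_nhds ?_)
        (mem_of_superset self_mem_nhdsWithin fun x hx => hx.2)
      exact continuous_subtype_val.continuousAt.preimage_mem_nhds (Icc_mem_nhds hs1.1 hs1.2)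
    · have h1 := lintegral_subinterval a s ha ({v | ¬ P v}.indicator 1)
      have h2 : ∫⁻ t, {v | ¬ P v}.indicator 1 (subinterval a s t) = (0 : ℝ≥0∞) := by
        rw [← lintegral_zero]
        refine lintegral_congr_ae ?_
        filter_upwards [hs2] with t ht
        simp [ht]
      have hPc : MeasurableSet {v | ¬ P v} := hP.compl
      rw [h2, mul_zero, lintegral_indicator_one hPc, Measure.restrict_apply hPc] at h1
      rw [inter_comm]
      exact h1.symm
  filter_upwards [ae_unitInterval_mem_Ioo, measure_eq_zero_iff_ae_notMem.1 key] with v h1 h2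
  by_contra h3
  exact h2 ⟨h1, h3⟩

lemma map_coe_nhdsNE_of_mem_Ioo {t : I} (ht : (t : ℝ) ∈ Ioo (0 : ℝ) 1) :
    map ((↑) : I → ℝ) (𝓝[≠] t) = 𝓝[≠] (t : ℝ) := by
  rw [map_coe_nhdsNE, Set.sdiff_eq, nhdsWithin_inter_of_mem]
  exact mem_nhdsWithin_of_mem_nhds (Icc_mem_nhds ht.1 ht.2)

lemma map_subinterval_nhdsNE {a : I} (ha : 0 < a) (s : I) {t : I}
    (ht : (t : ℝ) ∈ Ioo (0 : ℝ) 1) :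
    map (subinterval a s) (𝓝[≠] t) = 𝓝[≠] (subinterval a s t) := by
  have ha' : (0 : ℝ) < a := ha
  have ht' : (subinterval a s t : ℝ) ∈ Ioo (0 : ℝ) 1 := by
    have h1 := mul_nonneg (sub_nonneg.2 a.2.2) s.2.1
    have h2 := mul_le_mul_of_nonneg_left s.2.2 (sub_nonneg.2 a.2.2)
    have h3 := mul_pos ha' ht.1
    have h4 := mul_lt_mul_of_pos_left ht.2 ha'
    rw [coe_subinterval]
    constructor <;> linarith
  refine map_injective Subtype.val_injective ?_
  rw [map_coe_nhdsNE_of_mem_Ioo ht', map_map]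
  have h1 : ((↑) : I → ℝ) ∘ subinterval a s =
      (affineHomeomorph (a : ℝ) ((1 - a) * s) ha'.ne') ∘ ((↑) : I → ℝ) := by
    ext
    simp [add_comm]
  rw [h1, ← map_map, map_coe_nhdsNE_of_mem_Ioo ht,
    (affineHomeomorph (a : ℝ) ((1 - a) * s) ha'.ne').isEmbedding.map_nhdsWithin_eq,
    image_compl_eq (affineHomeomorph (a : ℝ) ((1 - a) * s) ha'.ne').bijective, image_singleton]
  simp [add_comm]

lemma tendsto_slope_subinterval (a s t : I) :
    Tendsto (fun s' => ((subinterval a s s' : ℝ) - subinterval a s t) / ((s' : ℝ) - t)) (𝓝[≠] t)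
      (𝓝 (a : ℝ)) := by
  refine tendsto_const_nhds.congr' ?_
  filter_upwards [self_mem_nhdsWithin] with s' hs
  have h2' : (s' : ℝ) - t ≠ 0 := sub_ne_zero.2 fun h' => hs (Subtype.ext h')
  rw [coe_subinterval, coe_subinterval]
  field_simp
  ring

/-- The restriction of a curve to a subinterval, parametrized on `[0,1]`. -/
def subcurve {X : Type*} [TopologicalSpace X] (γ : C(I, X)) (a s : I) : C(I, X) :=
  γ.comp ⟨subinterval a s, continuous_subinterval_right a s⟩

@[simp] lemma subcurve_apply {X : Type*} [TopologicalSpace X] (γ : C(I, X)) (a s t : I) :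
    subcurve γ a s t = γ (subinterval a s t) := rfl

variable {X : Type*} [MetricSpace X]

lemma metricSpeed_subcurve (γ : C(I, X)) {a : I} (ha : 0 < a) (s : I) {t : I}
    (ht : (t : ℝ) ∈ Ioo (0 : ℝ) 1) :
    metricSpeed (subcurve γ a s) t = ENNReal.ofReal a * metricSpeed γ (subinterval a s t) :=
  metricSpeed_comp (fun _ => rfl) ha (map_subinterval_nhdsNE ha s ht)
    (tendsto_slope_subinterval a s t)

lemma normalizedDeriv_subcurve (f : X → ℝ) (γ : C(I, X)) {a : I} (ha : 0 < a) (s : I) {t : I}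
    (ht : (t : ℝ) ∈ Ioo (0 : ℝ) 1) :
    normalizedDeriv f (t, subcurve γ a s) = normalizedDeriv f (subinterval a s t, γ) :=
  normalizedDeriv_comp f (fun _ => rfl) ha (map_subinterval_nhdsNE ha s ht)
    (tendsto_slope_subinterval a s t)

end Affine

/-! ### Reparametrization of curves -/

section Reparam

variable {X : Type*} [MetricSpace X]

/-- The metric speed of a curve, weighted by a function on the space. -/
noncomputable def weightedSpeed (h : X → ℝ≥0∞) (γ : C(I, X)) (r : I) : ℝ≥0∞ :=
  h (γ r) * metricSpeed γ r

/-- The weighted length of a curve. -/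
noncomputable def weightedLength (h : X → ℝ≥0∞) (γ : C(I, X)) : ℝ≥0∞ := ∫⁻ r, weightedSpeed h γ r

/-- The absolutely continuous curves of positive weighted length. -/
def properCurves (h : X → ℝ≥0∞) : Set C(I, X) := {γ | IsACCurve γ ∧ weightedLength h γ ≠ 0}

open Classical in
/-- The parametrization of a curve by its weighted length, normalized to `[0,1]`. -/
noncomputable def reparam (h : X → ℝ≥0∞) (γ : C(I, X)) : C(I, X) :=
  if H : γ ∈ properCurves h ∧ ∃ γ₁ : C(I, X),
    ∀ r, γ₁ (normalizedPrimitive (weightedSpeed h γ) r) = γ r then H.2.choose else γ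

variable [SecondCountableTopology X] [MeasurableSpace X] [BorelSpace X] {h : X → ℝ≥0∞}

lemma measurable_weightedSpeed_param (hh : Measurable h) :
    Measurable fun z : C(I, X) × I => weightedSpeed h z.1 z.2 := by
  have h1 : Measurable fun z : C(I, X) × I => (z.2, z.1) := measurable_swap
  have h2 : Measurable fun z : C(I, X) × I => metricSpeed z.1 z.2 := by
    simpa [Function.comp_def] using measurable_metricSpeed.comp h1
  have h3 : Measurable fun z : C(I, X) × I => h (z.1 z.2) := by
    simpa [Function.comp_def, evalCurve] using hh.comp (continuous_evalCurve.measurable.comp h1)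
  exact h3.mul h2

lemma measurable_weightedSpeed (hh : Measurable h) (γ : C(I, X)) :
    Measurable (weightedSpeed h γ) :=
  (hh.comp γ.continuous.measurable).mul (measurable_metricSpeed_curve γ)

lemma measurable_weightedLength (hh : Measurable h) : Measurable (weightedLength h) :=
  (measurable_weightedSpeed_param hh).lintegral_prod_right'

lemma measurableSet_properCurves (hh : Measurable h) : MeasurableSet (properCurves h) :=
  measurableSet_isACCurve.inter ((measurable_weightedLength hh) (measurableSet_singleton 0).compl)

lemma measurable_normalizedPrimitive_weightedSpeed (hh : Measurable h) :
    Measurable fun z : C(I, X) × I => normalizedPrimitive (weightedSpeed h z.1) z.2 := by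
  have h1 := measurable_primitive_param (measurable_weightedSpeed_param hh)
  exact continuous_projIcc.measurable.comp
    (h1.div (h1.comp (measurable_fst.prodMk measurable_const)))

lemma weightedLength_ne_top (hle : ∀ x, h x ≤ 1) {γ : C(I, X)} (hγ : IsACCurve γ) :
    weightedLength h γ ≠ ∞ :=
  ne_top_of_le_ne_top hγ.lintegral_metricSpeed_lt_top.ne
    (lintegral_mono fun r => mul_le_of_le_one_left' (hle (γ r)))

variable {γ : C(I, X)}

/-- The normalized weighted length is a continuous surjection of compact Hausdorff spaces, hence a
quotient map. The curve factors through it: as `h` is positive, no growth of weighted length on an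
interval means zero speed almost everywhere there, so the curve is constant. -/
lemma reparam_apply (hh : Measurable h) (hle : ∀ x, h x ≤ 1) (h0 : ∀ x, h x ≠ 0)
    (hγ : γ ∈ properCurves h) (r : I) :
    reparam h γ (normalizedPrimitive (weightedSpeed h γ) r) = γ r := by
  have hw := measurable_weightedSpeed hh γ
  have hfin := weightedLength_ne_top hle hγ.1
  have hc := continuous_normalizedPrimitive hw hfin
  have hex : ∃ γ₁ : C(I, X), ∀ r, γ₁ (normalizedPrimitive (weightedSpeed h γ) r) = γ r := by
    have hq : IsQuotientMap (normalizedPrimitive (weightedSpeed h γ)) :=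
      hc.isClosedMap.isQuotientMap hc (surjective_normalizedPrimitive hw hfin hγ.2)
    have hfac : ∀ r s, r ≤ s → normalizedPrimitive (weightedSpeed h γ) r =
        normalizedPrimitive (weightedSpeed h γ) s → γ r = γ s := by
      intro r s hrs heq
      have h1 := congrArg Subtype.val heq
      rw [coe_normalizedPrimitive hfin, coe_normalizedPrimitive hfin,
        div_left_inj' (primitive_one_pos hfin hγ.2).ne'] at h1
      have h2 := ofReal_primitive_sub hfin hrs
      rw [h1, sub_self, ENNReal.ofReal_zero, eq_comm, lintegral_eq_zero_iff hw] at h2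
      have h3 : ∫⁻ x in Icc r s, metricSpeed γ x = 0 := by
        rw [← lintegral_zero (μ := volume.restrict (Icc r s))]
        refine lintegral_congr_ae ?_
        filter_upwards [h2] with x hx
        exact (mul_eq_zero.1 hx).resolve_left (h0 _)
      have h4 := hγ.1.edist_le hrs
      rw [h3] at h4
      exact edist_le_zero.1 h4
    have hfac' : Function.FactorsThrough γ
        (⟨normalizedPrimitive (weightedSpeed h γ), hc⟩ : C(I, I)) := by
      intro r s heq
      rcases le_total r s with hrs | hrs
      · exact hfac r s hrs heq
      · exact (hfac s r hrs heq.symm).symm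
    refine ⟨IsQuotientMap.lift (f := ⟨normalizedPrimitive (weightedSpeed h γ), hc⟩) hq γ hfac',
      fun r => ?_⟩
    exact DFunLike.congr_fun (IsQuotientMap.lift_comp
      (f := ⟨normalizedPrimitive (weightedSpeed h γ), hc⟩) hq γ hfac') r
  rw [reparam, dif_pos ⟨hγ, hex⟩]
  exact hex.choose_spec r

/-- The value at `v` is the value of the original curve at the first time `τ` at which the
normalized weighted length reaches `v`. By continuity and monotonicity, `τ ≤ r` depends only on the
weighted length at `r`, which is measurable in the curve. -/
lemma measurable_reparam (hh : Measurable h) (hle : ∀ x, h x ≤ 1) (h0 : ∀ x, h x ≠ 0) :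
    Measurable (reparam h : C(I, X) → C(I, X)) := by
  classical
  refine measurable_curve_of_eval fun v => ?_
  obtain ⟨G, hGdef⟩ : ∃ G : Set C(I, X), G = properCurves h := ⟨_, rfl⟩
  have hG : MeasurableSet G := hGdef ▸ measurableSet_properCurves hh
  have hGA : ∀ γ ∈ G, γ ∈ properCurves h := fun γ hγ => hGdef ▸ hγ
  set τ : C(I, X) → I := fun γ =>
    if γ ∈ G then sInf {r | v ≤ normalizedPrimitive (weightedSpeed h γ) r} else 0
  have hmem : ∀ γ ∈ G, v ≤ normalizedPrimitive (weightedSpeed h γ)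
      (sInf {r | v ≤ normalizedPrimitive (weightedSpeed h γ) r}) := by
    intro γ hγ
    have hw := measurable_weightedSpeed hh γ
    have hfin := weightedLength_ne_top hle (hGA γ hγ).1
    have hcl : IsClosed {r | v ≤ normalizedPrimitive (weightedSpeed h γ) r} :=
      isClosed_le continuous_const (continuous_normalizedPrimitive hw hfin)
    refine hcl.sInf_mem ⟨1, ?_⟩
    rw [Set.mem_ofPred_eq, normalizedPrimitive_one hfin (hGA γ hγ).2]
    exact v.2.2
  have hτ : Measurable τ := by
    refine measurable_of_Iic fun r => ?_
    have : τ ⁻¹' Iic r = (G ∩ {γ | v ≤ normalizedPrimitive (weightedSpeed h γ) r}) ∪ Gᶜ := by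
      ext γ
      by_cases hγ : γ ∈ G
      · simp only [mem_preimage, τ, mem_Iic, mem_union, mem_inter_iff, hγ, true_and,
          Set.mem_ofPred_eq, mem_compl_iff, not_true, or_false]
        refine ⟨fun h1 => (hmem γ hγ).trans (monotone_normalizedPrimitive
          (weightedLength_ne_top hle (hGA γ hγ).1) h1), fun h1 => sInf_le h1⟩
      · simp only [mem_preimage, τ, mem_Iic, mem_union, mem_inter_iff, hγ, false_and,
          mem_compl_iff, not_false_iff, or_true, iff_true]
        exact r.2.1
    rw [this]
    refine (hG.inter (measurableSet_le measurable_const ?_)).union hG.compl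
    have h1 : Measurable fun γ : C(I, X) => (γ, r) := measurable_prodMk_right
    simpa [Function.comp_def] using (measurable_normalizedPrimitive_weightedSpeed hh).comp h1
  have heval : (fun γ : C(I, X) => reparam h γ v) =
      fun γ => if γ ∈ G then evalCurve (τ γ, γ) else evalCurve (v, γ) := by
    ext γ
    by_cases hγ : γ ∈ G
    · rw [if_pos hγ]
      obtain ⟨r, hr⟩ := surjective_normalizedPrimitive (measurable_weightedSpeed hh γ)
        (weightedLength_ne_top hle (hGA γ hγ).1) (hGA γ hγ).2 v
      have h1 : v = normalizedPrimitive (weightedSpeed h γ) (τ γ) := by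
        simp only [τ, if_pos hγ]
        refine le_antisymm (hmem γ hγ) ?_
        conv_rhs => rw [← hr]
        exact monotone_normalizedPrimitive (weightedLength_ne_top hle (hGA γ hγ).1) (sInf_le hr.ge)
      conv_lhs => rw [h1]
      exact reparam_apply hh hle h0 (hGA γ hγ) _
    · rw [if_neg hγ, reparam, dif_neg fun H => hγ (hGdef ▸ H.1)]
      rfl
  rw [heval]
  refine Measurable.ite hG ?_ ?_
  · exact continuous_evalCurve.measurable.comp (hτ.prodMk measurable_id)
  · exact continuous_evalCurve.measurable.comp (measurable_const.prodMk measurable_id)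

lemma ae_normalizedPrimitive {w : I → ℝ≥0∞} (hw : Measurable w) (hfin : ∫⁻ t, w t ≠ ∞)
    (hpos : ∫⁻ t, w t ≠ 0) {P : I → Prop} (hP : ∀ᵐ v, P v) :
    ∀ᵐ r, w r ≠ 0 → P (normalizedPrimitive w r) := by
  have hm := (continuous_normalizedPrimitive hw hfin).measurable
  have h1 : ∀ᵐ v ∂((∫⁻ t, w t) • (volume : Measure I)), P v := Measure.ae_smul_measure hP _
  rw [← map_normalizedPrimitive hw hfin hpos] at h1
  exact (ae_withDensity_iff hw).1 (ae_of_ae_map hm.aemeasurable h1)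

/-- Measurability of the property is essential here, since it is pulled back through an image
measure; the converse transfer above does without it. -/
lemma ae_of_ae_normalizedPrimitive {w : I → ℝ≥0∞} (hw : Measurable w) (hfin : ∫⁻ t, w t ≠ ∞)
    (hpos : ∫⁻ t, w t ≠ 0) {P : I → Prop} (hPm : MeasurableSet {v | P v})
    (hP : ∀ᵐ r, w r ≠ 0 → P (normalizedPrimitive w r)) : ∀ᵐ v, P v := by
  have hm := (continuous_normalizedPrimitive hw hfin).measurable
  have h1 := (ae_map_iff hm.aemeasurable hPm).2 ((ae_withDensity_iff hw).2 hP)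
  rw [map_normalizedPrimitive hw hfin hpos] at h1
  exact (Measure.ae_ennreal_smul_measure_iff hpos).1 h1

lemma metricSpeed_reparam (hh : Measurable h) (hle : ∀ x, h x ≤ 1) (h0 : ∀ x, h x ≠ 0)
    (hγ : γ ∈ properCurves h) :
    ∀ᵐ v, metricSpeed (reparam h γ) v = weightedLength h γ / h (reparam h γ v) := by
  have hw := measurable_weightedSpeed hh γ
  have hfin := weightedLength_ne_top hle hγ.1
  refine ae_of_ae_normalizedPrimitive hw hfin hγ.2 (measurableSet_eq_fun
    (measurable_metricSpeed_curve _) (measurable_const.div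
      (hh.comp (reparam h γ).continuous.measurable))) ?_
  filter_upwards [tendsto_slope_primitive hw hfin,
    ae_lt_top (measurable_metricSpeed_curve γ) hγ.1.lintegral_metricSpeed_lt_top.ne]
    with r hr hr' hr0
  have hhr : h (γ r) ≠ ∞ := ne_top_of_le_ne_top ENNReal.one_ne_top (hle _)
  have hwr : weightedSpeed h γ r ≠ ∞ := ENNReal.mul_ne_top hhr hr'.ne
  obtain ⟨h1, h2, h3⟩ := normalizedPrimitive_local hw hfin hγ.2 hr hwr hr0
  have hTdef : ∫⁻ t, weightedSpeed h γ t = weightedLength h γ := rfl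
  have h4 := metricSpeed_comp (fun s => (reparam_apply hh hle h0 hγ s).symm) h1 h2 h3
  have hs0 : metricSpeed γ r ≠ 0 := right_ne_zero_of_mul hr0
  rw [primitive_one, hTdef, ENNReal.ofReal_div_of_pos (ENNReal.toReal_pos hγ.2 hfin),
    ENNReal.ofReal_toReal hwr, ENNReal.ofReal_toReal hfin] at h4
  change metricSpeed γ r = h (γ r) * metricSpeed γ r / weightedLength h γ * _ at h4
  rw [reparam_apply hh hle h0 hγ]
  set S := metricSpeed (reparam h γ) (normalizedPrimitive (weightedSpeed h γ) r)
  have h5 : metricSpeed γ r * 1 = metricSpeed γ r * (h (γ r) * S / weightedLength h γ) := by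
    rw [mul_one]
    conv_lhs => rw [h4]
    simp only [div_eq_mul_inv]
    ring
  have h6 := (ENNReal.mul_right_inj hs0 hr'.ne).1 h5
  rw [ENNReal.eq_div_iff (h0 _) hhr]
  rw [eq_comm, ENNReal.div_eq_one_iff hγ.2 hfin] at h6
  exact h6

lemma normalizedDeriv_reparam (hh : Measurable h) (hle : ∀ x, h x ≤ 1) (h0 : ∀ x, h x ≠ 0)
    (hγ : γ ∈ properCurves h) (f : X → ℝ) {r : I}
    (hr : Tendsto (fun s : I => (primitive (weightedSpeed h γ) s - primitive (weightedSpeed h γ) r) /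
      ((s : ℝ) - r)) (𝓝[≠] r) (𝓝 (weightedSpeed h γ r).toReal))
    (hr' : weightedSpeed h γ r ≠ ∞) (hr0 : weightedSpeed h γ r ≠ 0) :
    normalizedDeriv f (r, γ) =
      normalizedDeriv f (normalizedPrimitive (weightedSpeed h γ) r, reparam h γ) := by
  obtain ⟨h1, h2, h3⟩ := normalizedPrimitive_local (measurable_weightedSpeed hh γ)
    (weightedLength_ne_top hle hγ.1) hγ.2 hr hr' hr0
  exact normalizedDeriv_comp f (fun s => (reparam_apply hh hle h0 hγ s).symm) h1 h2 h3

lemma lintegral_reparam (hh : Measurable h) (hle : ∀ x, h x ≤ 1) (h0 : ∀ x, h x ≠ 0)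
    (hγ : γ ∈ properCurves h) {g : X → ℝ≥0∞} (hg : Measurable g) :
    weightedLength h γ * ∫⁻ v, g (reparam h γ v) = ∫⁻ r, weightedSpeed h γ r * g (γ r) := by
  rw [weightedLength, ← lintegral_comp_normalizedPrimitive (measurable_weightedSpeed hh γ)
    (weightedLength_ne_top hle hγ.1) hγ.2 (show Measurable fun v => g (reparam h γ v) from hg.comp (reparam h γ).continuous.measurable)]
  simp only [reparam_apply hh hle h0 hγ]

/-- The dominating function is the expected speed, weighted length divided by `h`. Transported back
to the original time its integral is at most the length of the curve. -/
lemma isACCurve_reparam (hh : Measurable h) (hle : ∀ x, h x ≤ 1) (h0 : ∀ x, h x ≠ 0)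
    (hγ : γ ∈ properCurves h) : IsACCurve (reparam h γ) := by
  have hw := measurable_weightedSpeed hh γ
  have hfin := weightedLength_ne_top hle hγ.1
  have hhtop : ∀ x, h x ≠ ∞ := fun x => ne_top_of_le_ne_top ENNReal.one_ne_top (hle x)
  have hm : Measurable fun v => (h (reparam h γ v))⁻¹ :=
    (hh.comp (reparam h γ).continuous.measurable).inv
  refine isACCurve_of_edist_le (w := fun v => weightedLength h γ * (h (reparam h γ v))⁻¹)
    (hm.const_mul _) ?_ fun u v huv => ?_
  · rw [lintegral_const_mul _ hm, lintegral_reparam (g := fun x => (h x)⁻¹) hh hle h0 hγ hh.inv]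
    refine ne_top_of_le_ne_top hγ.1.lintegral_metricSpeed_lt_top.ne (lintegral_mono fun r => ?_)
    rw [weightedSpeed, mul_right_comm]
    exact mul_le_of_le_one_left' (ENNReal.mul_inv_le_one _)
  -- Strict inequality is what makes arbitrarily chosen preimages of the two times ordered.
  · rcases huv.eq_or_lt with rfl | huv
    · simp
    obtain ⟨r, rfl⟩ := surjective_normalizedPrimitive hw hfin hγ.2 u
    obtain ⟨s, rfl⟩ := surjective_normalizedPrimitive hw hfin hγ.2 v
    have hmono := monotone_normalizedPrimitive hfin
    have hrs : r ≤ s := (hmono.reflect_lt huv).le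
    rw [reparam_apply hh hle h0 hγ, reparam_apply hh hle h0 hγ, lintegral_const_mul _ hm,
      ← lintegral_indicator measurableSet_Icc, weightedLength,
      ← lintegral_comp_normalizedPrimitive hw hfin hγ.2 (hm.indicator measurableSet_Icc)]
    refine (hγ.1.edist_le hrs).trans ?_
    rw [← lintegral_indicator measurableSet_Icc]
    refine lintegral_mono fun x => ?_
    by_cases hx : x ∈ Icc r s
    · have hx' : normalizedPrimitive (weightedSpeed h γ) x ∈
        Icc (normalizedPrimitive (weightedSpeed h γ) r)
          (normalizedPrimitive (weightedSpeed h γ) s) := ⟨hmono hx.1, hmono hx.2⟩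
      simp only [indicator_of_mem hx, indicator_of_mem hx', reparam_apply hh hle h0 hγ,
        weightedSpeed]
      rw [mul_right_comm, ENNReal.mul_inv_cancel (h0 _) (hhtop _), one_mul]
    · simp [indicator_of_notMem hx]

end Reparam

/-! ### Disintegrations -/

section Disintegration

variable {Z Y : Type*} [MeasurableSpace Z] [MeasurableSpace Y] {φ : Z → Y}

/-- Weighting by `g ∘ φ`, with `g` positive and integrable for the image measure, makes the measure
finite. The conditional kernel of the joint law of `(φ z, z)` lives on the fibres, because the joint
law lives on the graph of `φ`; the weight is constant on fibres and cancels. -/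
lemma exists_isDisintegration [StandardBorelSpace Z] [TopologicalSpace Y] [T2Space Y]
    [SecondCountableTopology Y] [BorelSpace Y] [Nonempty Z] (hφ : Measurable φ) (π : Measure Z)
    [SigmaFinite (π.map φ)] : ∃ κ : Kernel Y Z, IsDisintegration φ π κ := by
  obtain ⟨g, hg0, hg, hglt⟩ := exists_pos_lintegral_lt_of_sigmaFinite (π.map φ) one_ne_zero
  have hgm : Measurable fun y => (g y : ℝ≥0∞) := hg.coe_nnreal_ennreal
  have hgφ : Measurable fun z => (g (φ z) : ℝ≥0∞) := hgm.comp hφ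
  have hpair : Measurable fun z => (φ z, z) := hφ.prodMk measurable_id
  set π' := π.withDensity fun z => (g (φ z) : ℝ≥0∞)
  have hfin : IsFiniteMeasure π' := isFiniteMeasure_withDensity (by
    rw [lintegral_map hgm hφ] at hglt
    exact (hglt.trans ENNReal.one_lt_top).ne)
  set ρ := π'.map fun z => (φ z, z)
  have hfst : ρ.fst = (π.map φ).withDensity fun y => (g y : ℝ≥0∞) := by
    rw [Measure.fst, Measure.map_map measurable_fst hpair]
    ext s hs
    change π'.map φ s = _
    rw [Measure.map_apply hφ hs, withDensity_apply _ (hφ hs), withDensity_apply _ hs,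
      setLIntegral_map hs hgm hφ]
  refine ⟨ρ.condKernel, inferInstance, ?_, fun G hG => ?_⟩
  · have hdiag : MeasurableSet {x : Y × Z | φ x.2 ≠ x.1} := by
      have : MeasurableSet {x : Y × Z | φ x.2 = x.1} :=
        ((hφ.comp measurable_snd).prodMk measurable_fst)
          (isClosed_diagonal (X := Y)).measurableSet
      exact this.compl
    have h1 : ρ {x : Y × Z | φ x.2 ≠ x.1} = 0 := by
      rw [Measure.map_apply hpair hdiag]
      simp
    have h2 : ∀ᵐ x ∂(ρ.fst ⊗ₘ ρ.condKernel), φ x.2 = x.1 := by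
      rw [ρ.disintegrate ρ.condKernel]
      exact h1
    have h3 := Measure.ae_ae_of_ae_compProd h2
    rw [hfst, ae_withDensity_iff hgm] at h3
    filter_upwards [h3] with y hy
    exact hy (by simpa using (hg0 y).ne')
  · have hGm : Measurable fun x : Y × Z => (g x.1 : ℝ≥0∞)⁻¹ * G x.2 :=
      (hgm.comp measurable_fst).inv.mul (hG.comp measurable_snd)
    have hne : ∀ y, (g y : ℝ≥0∞) ≠ 0 := fun y => by simpa using (hg0 y).ne'
    have h1 := Measure.lintegral_condKernel (ρ := ρ) hGm
    rw [lintegral_map hGm hpair, hfst] at h1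
    rw [lintegral_withDensity_eq_lintegral_mul (g := fun z => (g (φ z) : ℝ≥0∞)⁻¹ * G z) _ hgφ
      (hGm.comp hpair)] at h1
    rw [lintegral_withDensity_eq_lintegral_mul _ hgm (Measurable.lintegral_kernel_prod_right'
      (κ := ρ.condKernel) hGm)] at h1
    simp only [Pi.mul_apply] at h1
    have e1 : ∀ z, (g (φ z) : ℝ≥0∞) * ((g (φ z) : ℝ≥0∞)⁻¹ * G z) = G z := fun z => by
      rw [← mul_assoc, ENNReal.mul_inv_cancel (hne _) ENNReal.coe_ne_top, one_mul]
    have e2 : ∀ y, (g y : ℝ≥0∞) * ∫⁻ z, (g y : ℝ≥0∞)⁻¹ * G z ∂ρ.condKernel y =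
        ∫⁻ z, G z ∂ρ.condKernel y := fun y => by
      rw [lintegral_const_mul _ hG, ← mul_assoc, ENNReal.mul_inv_cancel (hne _)
        ENNReal.coe_ne_top, one_mul]
    simp only [e1, e2] at h1
    exact h1.symm

lemma exists_isDisintegration_of_isEmpty [IsEmpty Y] (π : Measure Z) :
    ∃ κ : Kernel Y Z, IsDisintegration φ π κ := by
  have : IsEmpty Z := Function.isEmpty φ
  refine ⟨0, ⟨fun y => isEmptyElim y⟩, ?_, fun G _ => ?_⟩
  · exact Eventually.of_forall fun y => isEmptyElim y
  · rw [Measure.eq_zero_of_isEmpty π]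
    simp

variable {π π' : Measure Z} {κ κ' : Kernel Y Z}

lemma IsDisintegration.ae_ae (hκ : IsDisintegration φ π κ) {P : Z → Prop}
    (hP : ∀ᵐ z ∂π, P z) : ∀ᵐ y ∂(π.map φ), ∀ᵐ z ∂(κ y), P z := by
  obtain ⟨N, hN, hNm, hN0⟩ := exists_measurable_superset_of_null (ae_iff.1 hP)
  have h := hκ.lintegral_eq (N.indicator 1) (measurable_one.indicator hNm)
  simp only [lintegral_indicator_one hNm] at h
  rw [hN0, eq_comm, lintegral_eq_zero_iff (κ.measurable_coe hNm)] at h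
  filter_upwards [h] with y hy
  exact measure_mono_null hN hy

lemma IsDisintegration.measure_inter_preimage (hκ : IsDisintegration φ π κ) (hφ : Measurable φ)
    {S : Set Z} (hS : MeasurableSet S) {E : Set Y} (hE : MeasurableSet E) :
    π (S ∩ φ ⁻¹' E) = ∫⁻ y in E, κ y S ∂(π.map φ) := by
  have hm := hS.inter (hφ hE)
  have h := hκ.lintegral_eq ((S ∩ φ ⁻¹' E).indicator 1) (measurable_one.indicator hm)
  simp only [lintegral_indicator_one hm] at h
  rw [h, ← lintegral_indicator hE]
  refine lintegral_congr_ae ?_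
  filter_upwards [hκ.concentrated] with y hy
  by_cases hyE : y ∈ E
  · rw [indicator_of_mem hyE]
    refine measure_congr ?_
    filter_upwards [hy] with z hz
    refine propext ⟨fun h => h.1, fun h => ⟨h, ?_⟩⟩
    change φ z ∈ E
    rwa [hz]
  · rw [indicator_of_notMem hyE]
    refine measure_eq_zero_iff_ae_notMem.2 ?_
    filter_upwards [hy] with z hz h
    have : φ z ∈ E := h.2
    rw [hz] at this
    exact hyE this

/-- If the superlevel sets of two functions over all measurable sets of the base have measure zero
simultaneously, their essential suprema over the fibres coincide. -/
lemma ae_eLpNorm_top_eq (hφ : Measurable φ) (hκ : IsDisintegration φ π κ)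
    (hκ' : IsDisintegration φ π' κ') (hac : π.map φ ≪ π'.map φ)
    {F F₀ F₁ : Z → ℝ} (hF₀ : Measurable F₀) (hF₁ : Measurable F₁) (h₀ : F =ᵐ[π] F₀)
    (h₁ : F =ᵐ[π'] F₁)
    (H : ∀ (c : ℝ≥0∞) (E : Set Y), MeasurableSet E →
      (π ({z | c < ‖F₀ z‖ₑ} ∩ φ ⁻¹' E) = 0 ↔ π' ({z | c < ‖F₁ z‖ₑ} ∩ φ ⁻¹' E) = 0)) :
    ∀ᵐ y ∂(π.map φ), eLpNorm F ∞ (κ y) = eLpNorm F ∞ (κ' y) := by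
  have hm₀ : ∀ c, MeasurableSet {z | c < ‖F₀ z‖ₑ} := fun c =>
    measurableSet_lt measurable_const hF₀.enorm
  have hm₁ : ∀ c, MeasurableSet {z | c < ‖F₁ z‖ₑ} := fun c =>
    measurableSet_lt measurable_const hF₁.enorm
  have key₀ : ∀ᵐ y ∂(π.map φ), ∀ r : ℚ, κ y {z | (Real.toNNReal r : ℝ≥0∞) < ‖F₀ z‖ₑ} = 0 →
      κ' y {z | (Real.toNNReal r : ℝ≥0∞) < ‖F₁ z‖ₑ} = 0 := by
    refine ae_all_iff.2 fun r => ?_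
    obtain ⟨c, hc⟩ : ∃ c : ℝ≥0∞, c = (Real.toNNReal r : ℝ≥0∞) := ⟨_, rfl⟩
    rw [← hc]
    -- The hypothesis is tested on the set of base points whose fibre does not see the superlevel
    -- set. Countably many rational levels suffice to recover the essential supremum.
    have hE : MeasurableSet {y | κ y {z | c < ‖F₀ z‖ₑ} = 0} :=
      κ.measurable_coe (hm₀ c) (measurableSet_singleton 0)
    have h2 : π ({z | c < ‖F₀ z‖ₑ} ∩ φ ⁻¹' {y | κ y {z | c < ‖F₀ z‖ₑ} = 0}) = 0 := by
      rw [hκ.measure_inter_preimage hφ (hm₀ c) hE]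
      exact (setLIntegral_congr_fun hE fun y hy => hy).trans lintegral_zero
    rw [H c _ hE, hκ'.measure_inter_preimage hφ (hm₁ c) hE,
      lintegral_eq_zero_iff (κ'.measurable_coe (hm₁ c))] at h2
    exact hac.ae_le ((ae_restrict_iff' hE).1 h2)
  have key₁ : ∀ᵐ y ∂(π.map φ), ∀ r : ℚ, κ' y {z | (Real.toNNReal r : ℝ≥0∞) < ‖F₁ z‖ₑ} = 0 →
      κ y {z | (Real.toNNReal r : ℝ≥0∞) < ‖F₀ z‖ₑ} = 0 := by
    refine ae_all_iff.2 fun r => ?_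
    obtain ⟨c, hc⟩ : ∃ c : ℝ≥0∞, c = (Real.toNNReal r : ℝ≥0∞) := ⟨_, rfl⟩
    rw [← hc]
    have hE : MeasurableSet {y | κ' y {z | c < ‖F₁ z‖ₑ} = 0} :=
      κ'.measurable_coe (hm₁ c) (measurableSet_singleton 0)
    have h2 : π' ({z | c < ‖F₁ z‖ₑ} ∩ φ ⁻¹' {y | κ' y {z | c < ‖F₁ z‖ₑ} = 0}) = 0 := by
      rw [hκ'.measure_inter_preimage hφ (hm₁ c) hE]
      exact (setLIntegral_congr_fun hE fun y hy => hy).trans lintegral_zero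
    rw [← H c _ hE, hκ.measure_inter_preimage hφ (hm₀ c) hE,
      lintegral_eq_zero_iff (κ.measurable_coe (hm₀ c))] at h2
    exact (ae_restrict_iff' hE).1 h2
  have aux : ∀ {ν ν' : Measure Z} {G G' : Z → ℝ},
      (∀ r : ℚ, ν {z | (Real.toNNReal r : ℝ≥0∞) < ‖G z‖ₑ} = 0 →
        ν' {z | (Real.toNNReal r : ℝ≥0∞) < ‖G' z‖ₑ} = 0) →
      eLpNorm G' ∞ ν' ≤ eLpNorm G ∞ ν := by
    intro ν ν' G G' h
    refine le_of_forall_gt fun b hb => ?_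
    obtain ⟨r, -, hr1, hr2⟩ := ENNReal.lt_iff_exists_rat_btwn.1 hb
    refine lt_of_le_of_lt ?_ hr2
    have h3 : ν {z | (Real.toNNReal r : ℝ≥0∞) < ‖G z‖ₑ} = 0 := by
      rw [eLpNorm_exponent_top] at hr1
      refine measure_eq_zero_iff_ae_notMem.2 ?_
      filter_upwards [ae_lt_of_essSup_lt hr1] with z hz h'
      exact lt_asymm hz h'
    rw [eLpNorm_exponent_top]
    refine essSup_le_of_ae_le _ ?_
    filter_upwards [measure_eq_zero_iff_ae_notMem.1 (h r h3)] with z hz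
    exact not_lt.1 hz
  filter_upwards [key₀, key₁, hκ.ae_ae h₀, hac.ae_le (hκ'.ae_ae h₁)] with y hy0 hy1 hy2 hy3
  rw [eLpNorm_congr_ae hy2, eLpNorm_congr_ae hy3]
  exact le_antisymm (aux hy1) (aux hy0)

end Disintegration

/-! ### Barycenters, modulus and Newton–Sobolev functions -/

section Modulus

variable {X : Type*} [MetricSpace X] [SecondCountableTopology X] [MeasurableSpace X]
  [BorelSpace X] {μ : Measure X} {p q : ℝ≥0∞} {η : Measure C(I, X)} {ρ : X → ℝ≥0∞}

lemma lintegral_speedMeasure (η : Measure C(I, X)) [SFinite η] {G : I × C(I, X) → ℝ≥0∞}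
    (hG : Measurable G) :
    ∫⁻ z, G z ∂(speedMeasure η) = ∫⁻ γ, (∫⁻ t : I, metricSpeed γ t * G (t, γ)) ∂η := by
  rw [speedMeasure, lintegral_withDensity_eq_lintegral_mul _ measurable_metricSpeed hG,
    lintegral_prod_symm' _ (measurable_metricSpeed.mul hG)]
  rfl

lemma lintegral_barycenter (η : Measure C(I, X)) [SFinite η] {g : X → ℝ≥0∞}
    (hg : Measurable g) : ∫⁻ x, g x ∂(barycenter η) = ∫⁻ γ, weightedLength g γ ∂η := by
  rw [barycenter, lintegral_map hg continuous_evalCurve.measurable,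
    lintegral_speedMeasure (G := fun z => g (evalCurve z)) η
      (hg.comp continuous_evalCurve.measurable)]
  simp only [weightedLength, weightedSpeed, evalCurve, mul_comm]

lemma curveIntegral_zero_one (g : X → ℝ≥0∞) (γ : C(I, X)) :
    curveIntegral g γ 0 1 = weightedLength g γ := by
  have : Icc (0 : I) 1 = univ := eq_univ_of_forall fun r => ⟨r.2.1, r.2.2⟩
  rw [curveIntegral, this, Measure.restrict_univ]
  rfl

/-- Hölder's inequality for nonnegative functions, including the end point exponents. -/
lemma lintegral_mul_le_eLpNorm_mul_eLpNorm {Ω : Type*} [MeasurableSpace Ω] {ν : Measure Ω}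
    (hpq : p.HolderConjugate q) {f g : Ω → ℝ≥0∞} (hf : Measurable f) (hg : Measurable g) :
    ∫⁻ x, f x * g x ∂ν ≤ eLpNorm f p ν * eLpNorm g q ν := by
  have hend : ∀ {f g : Ω → ℝ≥0∞}, Measurable f → Measurable g →
      ∫⁻ x, f x * g x ∂ν ≤ eLpNorm f 1 ν * eLpNorm g ∞ ν := by
    intro f g hf hg
    rw [eLpNorm_one_eq_lintegral_enorm, eLpNorm_exponent_top]
    simp only [enorm_eq_self]
    rw [← lintegral_mul_const _ hf]
    refine lintegral_mono_ae ?_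
    filter_upwards [enorm_ae_le_eLpNormEssSup g ν] with x hx
    simp only [enorm_eq_self] at hx
    gcongr
  rcases eq_or_ne p ∞ with rfl | hp
  · have : q = 1 := by
      have := hpq.inv_add_inv_eq_one
      simpa using this
    subst this
    rw [mul_comm]
    simp_rw [mul_comm (f _)]
    exact hend hg hf
  rcases eq_or_ne q ∞ with rfl | hq
  · have : p = 1 := by
      have := hpq.inv_add_inv_eq_one
      simpa using this
    subst this
    exact hend hf hg
  have hp0 : p ≠ 0 := hpq.ne_zero
  have hq0 : q ≠ 0 := hpq.symm.ne_zero
  have hpq' : p.toReal.HolderConjugate q.toReal := by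
    rw [Real.holderConjugate_iff]
    constructor
    · have h1 : 1 < p := by
        have := hpq.symm
        exact (ENNReal.HolderConjugate.lt_top_iff_one_lt q p).1 hq.lt_top
      simpa using (ENNReal.toReal_lt_toReal ENNReal.one_ne_top hp).2 h1
    · have h1 := congrArg ENNReal.toReal hpq.inv_add_inv_eq_one
      rwa [ENNReal.toReal_add (by simpa) (by simpa), ENNReal.toReal_inv, ENNReal.toReal_inv,
        ENNReal.toReal_one] at h1
  rw [eLpNorm_eq_lintegral_rpow_enorm_toReal hp0 hp, eLpNorm_eq_lintegral_rpow_enorm_toReal hq0 hq]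
  exact ENNReal.lintegral_mul_le_Lp_mul_Lq ν hpq' hf.aemeasurable hg.aemeasurable

lemma lintegral_barycenter_le (hpq : p.HolderConjugate q) (hρ : Measurable ρ)
    (hbar : barycenter η ≤ μ.withDensity ρ) {g : X → ℝ≥0∞} (hg : Measurable g) :
    ∫⁻ x, g x ∂(barycenter η) ≤ eLpNorm g p μ * eLpNorm ρ q μ := by
  refine (lintegral_mono' hbar le_rfl).trans ?_
  rw [lintegral_withDensity_eq_lintegral_mul _ hρ hg, mul_comm ρ g]
  exact lintegral_mul_le_eLpNorm_mul_eLpNorm hpq hg hρ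

/-- Families of curves of zero modulus are negligible for plans with a barycenter in the dual
space. -/
lemma measure_eq_zero_of_curveModulus_eq_zero [SFinite η] (hpq : p.HolderConjugate q)
    (hρ : Measurable ρ) (hρq : eLpNorm ρ q μ < ∞) (hbar : barycenter η ≤ μ.withDensity ρ)
    {Γ : Set C(I, X)} (hΓ : curveModulus p μ Γ = 0) : η Γ = 0 := by
  have hp0 : p ≠ 0 := hpq.ne_zero
  have hsmall : ∀ ε : ℝ≥0∞, 0 < ε → ε ≠ ∞ → ∃ g : X → ℝ≥0∞, Measurable g ∧
      (∀ γ ∈ Γ, 1 ≤ weightedLength g γ) ∧ eLpNorm g p μ < ε := by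
    intro ε hε hε'
    rcases eq_or_ne p ∞ with rfl | hp
    · have h1 : curveModulus ∞ μ Γ < ε := hΓ ▸ hε
      simp only [curveModulus, iInf_lt_iff, if_true] at h1
      obtain ⟨g, hg, hgΓ, hlt⟩ := h1
      exact ⟨g, hg, fun γ hγ => by simpa [curveIntegral_zero_one] using hgΓ γ hγ, by
        simpa [eLpNorm_exponent_top, eLpNormEssSup] using hlt⟩
    · have hpr : 0 < p.toReal := ENNReal.toReal_pos hp0 hp
      have h1 : curveModulus p μ Γ < ε ^ p.toReal := by
        rw [hΓ]
        exact ENNReal.rpow_pos hε hε'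
      simp only [curveModulus, iInf_lt_iff, if_neg hp] at h1
      obtain ⟨g, hg, hgΓ, hlt⟩ := h1
      refine ⟨g, hg, fun γ hγ => by simpa [curveIntegral_zero_one] using hgΓ γ hγ, ?_⟩
      rw [eLpNorm_eq_lintegral_rpow_enorm_toReal hp0 hp, one_div]
      simp only [enorm_eq_self]
      rwa [ENNReal.rpow_inv_lt_iff hpr]
  -- Chebyshev's inequality for the line integral of an admissible function of small norm, then
  -- Hölder's inequality against the density of the barycenter.
  have hbound : ∀ ε : ℝ≥0∞, 0 < ε → ε ≠ ∞ → η Γ ≤ ε * eLpNorm ρ q μ := by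
    intro ε hε hε'
    obtain ⟨g, hg, hgΓ, hlt⟩ := hsmall ε hε hε'
    calc η Γ ≤ η {γ | 1 ≤ weightedLength g γ} := measure_mono fun γ hγ => hgΓ γ hγ
      _ ≤ ∫⁻ γ, weightedLength g γ ∂η := by
        simpa using mul_meas_ge_le_lintegral (μ := η) (measurable_weightedLength hg) 1
      _ ≤ eLpNorm g p μ * eLpNorm ρ q μ := by
        rw [← lintegral_barycenter η hg]
        exact lintegral_barycenter_le hpq hρ hbar hg
      _ ≤ _ := by gcongr
  refine le_antisymm (ENNReal.le_of_forall_pos_le_add fun ε hε _ => ?_) bot_le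
  rw [zero_add]
  set C := eLpNorm ρ q μ
  have h2 := hbound (ε / (C + 1)) (ENNReal.div_pos (by simpa using hε.ne') (by simp [hρq.ne]))
    (ENNReal.div_ne_top ENNReal.coe_ne_top (by simp))
  refine h2.trans ?_
  rw [ENNReal.mul_comm_div]
  refine mul_le_of_le_one_right' ?_
  exact ENNReal.div_le_of_le_mul (by simp)

/-- Newton–Sobolev functions are continuous along almost every curve. -/
lemma ae_continuous_comp [IsFiniteMeasure η] (hac : ∀ᵐ γ ∂η, IsACCurve γ)
    (hpq : p.HolderConjugate q)
    (hρ : Measurable ρ) (hρq : eLpNorm ρ q μ < ∞) (hbar : barycenter η ≤ μ.withDensity ρ)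
    {f : X → ℝ} (hf : MemNewtonSobolev p μ f) : ∀ᵐ γ : C(I, X) ∂η, Continuous (f ∘ γ) := by
  obtain ⟨-, g, ⟨hg, hmod⟩, hgp⟩ := hf
  have h1 := measure_eq_zero_of_curveModulus_eq_zero hpq hρ hρq hbar hmod
  have h2 : ∫⁻ γ, weightedLength g γ ∂η ≠ ∞ := by
    rw [← lintegral_barycenter η hg]
    exact ((lintegral_barycenter_le hpq hρ hbar hg).trans_lt (ENNReal.mul_lt_top hgp hρq)).ne
  filter_upwards [hac, measure_eq_zero_iff_ae_notMem.1 h1, ae_lt_top (measurable_weightedLength hg) h2]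
    with γ hγ hΓ hfin
  have h3 : ∀ s t : I, s ≤ t → edist (f (γ t)) (f (γ s)) ≤ curveIntegral g γ s t := by
    by_contra h
    exact hΓ ⟨hγ, h⟩
  have h4 := dist_le_primitive (u := f ∘ γ) hfin.ne fun s t hst => by
    rw [edist_comm]
    exact h3 s t hst
  have hc := continuous_primitive (measurable_weightedSpeed hg γ) hfin.ne
  refine continuous_iff_continuousAt.2 fun t => ?_
  rw [ContinuousAt, tendsto_iff_dist_tendsto_zero]
  refine squeeze_zero (fun _ => dist_nonneg) (fun s => h4 s t) ?_
  have h5 : Continuous fun s => |primitive (weightedSpeed g γ) t - primitive (weightedSpeed g γ) s| :=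
    (continuous_const.sub hc).abs
  simpa using h5.tendsto t

lemma measurable_deriv_IccExtend :
    Measurable fun z : C(I, ℝ) × ℝ => deriv (IccExtend (zero_le_one' ℝ) z.1) z.2 := by
  refine measurable_deriv_with_param (f := fun g : C(I, ℝ) => IccExtend (zero_le_one' ℝ) g) ?_
  have : Continuous fun z : C(I, ℝ) × ℝ => z.1 (projIcc 0 1 (zero_le_one' ℝ) z.2) :=
    ContinuousEval.continuous_eval.comp (f := fun z : C(I, ℝ) × ℝ =>
      (z.1, projIcc 0 1 (zero_le_one' ℝ) z.2))
      (continuous_fst.prodMk (continuous_projIcc.comp continuous_snd))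
  exact this

/-- Normalized derivatives of Newton–Sobolev functions are measurable with respect to plans of
curves with nonzero speed. -/
lemma aemeasurable_normalizedDeriv [IsFiniteMeasure η] (hac : ∀ᵐ γ ∂η, IsACCurve γ)
    (hspeed : ∀ᵐ z ∂((volume : Measure I).prod η), metricSpeed z.2 z.1 ≠ 0)
    (hpq : p.HolderConjugate q)
    (hρ : Measurable ρ) (hρq : eLpNorm ρ q μ < ∞) (hbar : barycenter η ≤ μ.withDensity ρ)
    {f : X → ℝ} (hf : MemNewtonSobolev p μ f) :
    AEMeasurable (normalizedDeriv f) ((volume : Measure I).prod η) := by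
  classical
  have hcont := ae_continuous_comp hac hpq hρ hρq hbar hf
  have hfm : AEMeasurable f μ := hf.1.1.aemeasurable
  have hμac : barycenter η ≪ μ :=
    (Measure.absolutelyContinuous_of_le hbar).trans (withDensity_absolutelyContinuous _ _)
  -- The barycenter controls only times of nonzero speed; `hspeed` removes this restriction.
  have h1 : ∀ᵐ t : I, ∀ᵐ γ ∂η, f (γ t) = hfm.mk f (γ t) := by
    have h2 : ∀ᵐ z ∂(speedMeasure η), f (evalCurve z) = hfm.mk f (evalCurve z) :=
      ae_of_ae_map continuous_evalCurve.measurable.aemeasurable (hμac.ae_le hfm.ae_eq_mk)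
    rw [speedMeasure, ae_withDensity_iff measurable_metricSpeed] at h2
    refine Measure.ae_ae_of_ae_prod (μ := volume) (ν := η)
      (p := fun z : I × C(I, X) => f (z.2 z.1) = hfm.mk f (z.2 z.1)) ?_
    filter_upwards [h2, hspeed] with z hz hz'
    exact hz hz'
  obtain ⟨D, hDsub, hDc, hDd⟩ := (Measure.dense_of_ae h1).exists_countable_dense_subset
  have h3 : ∀ᵐ γ ∂η, ∀ t ∈ D, f (γ t) = hfm.mk f (γ t) :=
    (ae_ball_iff hDc).2 fun t ht => hDsub ht
  obtain ⟨N, hN, hNm, hN0⟩ := exists_measurable_superset_of_null (ae_iff.1 (hcont.and h3))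
  have hNprop : ∀ γ, γ ∉ N → Continuous (f ∘ γ) ∧ ∀ t ∈ D, f (γ t) = hfm.mk f (γ t) := by
    intro γ hγ
    by_contra h
    exact hγ (hN h)
  -- Off a null set this is `γ ↦ f ∘ γ`. Its evaluation at any time is a limit of evaluations at
  -- times of the countable dense set `D`, where the Borel representative of `f` may be used.
  set J : C(I, X) → C(I, ℝ) := fun γ =>
    if h : γ ∈ N then 0 else ⟨f ∘ γ, (hNprop γ h).1⟩
  have hJ : Measurable J := by
    refine measurable_curve_of_eval fun t => ?_
    obtain ⟨u, huD, hut⟩ := mem_closure_iff_seq_limit.1 (hDd t)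
    refine measurable_of_tendsto_metrizable
      (f := fun n γ => if γ ∈ N then 0 else hfm.mk f (γ (u n))) (fun n => ?_) ?_
    · refine Measurable.ite hNm measurable_const (hfm.measurable_mk.comp ?_)
      exact Continuous.measurable (by fun_prop)
    · rw [tendsto_pi_nhds]
      intro γ
      by_cases hγ : γ ∈ N
      · simp [J, hγ]
      · simp only [J, hγ, if_false, dif_neg, not_false_iff]
        have h5 := ((hNprop γ hγ).1.tendsto t).comp hut
        refine h5.congr fun n => ?_
        exact (hNprop γ hγ).2 _ (huD n)
  have hmeas : Measurable fun z : I × C(I, X) =>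
      deriv (IccExtend (zero_le_one' ℝ) (J z.2)) (z.1 : ℝ) / (metricSpeed z.2 z.1).toReal := by
    refine Measurable.div ?_ measurable_metricSpeed.ennreal_toReal
    have : Measurable fun z : I × C(I, X) => (J z.2, (z.1 : ℝ)) :=
      (hJ.comp measurable_snd).prodMk (measurable_subtype_coe.comp measurable_fst)
    simpa [Function.comp_def] using measurable_deriv_IccExtend.comp this
  refine ⟨_, hmeas, ?_⟩
  have ht : ∀ᵐ z ∂((volume : Measure I).prod η), (z.1 : ℝ) ∈ Ioo (0 : ℝ) 1 :=
    Measure.quasiMeasurePreserving_fst.ae ae_unitInterval_mem_Ioo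
  have hγ : ∀ᵐ z ∂((volume : Measure I).prod η), z.2 ∉ N :=
    Measure.quasiMeasurePreserving_snd.ae (measure_eq_zero_iff_ae_notMem.1 hN0)
  filter_upwards [ht, hγ] with z hz1 hz2
  rw [normalizedDeriv, derivWithin_of_mem_nhds (Icc_mem_nhds hz1.1 hz1.2)]
  simp only [J, dif_neg hz2]
  rfl

end Modulus

/-! ### Plans of random subcurves -/

section ResampledPlan

variable {X : Type*} [MetricSpace X] [SecondCountableTopology X] [MeasurableSpace X]
  [BorelSpace X] {μ : Measure X} {η : Measure C(I, X)} {h : X → ℝ≥0∞}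

lemma ae_volume_prod_iff [SFinite η] {P : I × C(I, X) → Prop} (hP : MeasurableSet {z | P z}) :
    (∀ᵐ z ∂((volume : Measure I).prod η), P z) ↔ ∀ᵐ γ ∂η, ∀ᵐ t : I, P (t, γ) :=
  (Measure.ae_prod_iff_ae_ae hP).trans (Measure.ae_ae_comm (p := fun t γ => P (t, γ)) hP)

lemma measurableSet_ae_volume {P : I × C(I, X) → Prop} (hP : MeasurableSet {z | P z}) :
    MeasurableSet {γ : C(I, X) | ∀ᵐ t : I, P (t, γ)} := by
  have h1 : Measurable fun γ : C(I, X) => volume ((fun t : I => (t, γ)) ⁻¹' {z | P z}ᶜ) :=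
    measurable_measure_prodMk_right hP.compl
  exact h1 (measurableSet_singleton 0)

lemma speedMeasure_eq_zero_iff [SFinite η] {S : Set (I × C(I, X))} (hS : MeasurableSet S) :
    speedMeasure η S = 0 ↔ ∀ᵐ γ ∂η, ∀ᵐ t : I, metricSpeed γ t ≠ 0 → (t, γ) ∉ S := by
  have hne : MeasurableSet {z : I × C(I, X) | metricSpeed z.2 z.1 ≠ 0 → z ∉ S} := by
    have h1 : MeasurableSet {z : I × C(I, X) | metricSpeed z.2 z.1 ≠ 0} :=
      measurable_metricSpeed (measurableSet_singleton 0).compl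
    have h2 : {z : I × C(I, X) | metricSpeed z.2 z.1 ≠ 0 → z ∉ S} =
        {z : I × C(I, X) | metricSpeed z.2 z.1 ≠ 0}ᶜ ∪ Sᶜ := by
      ext z
      simp only [Set.mem_ofPred_eq, mem_union, mem_compl_iff]
      tauto
    rw [h2]
    exact h1.compl.union hS.compl
  rw [measure_eq_zero_iff_ae_notMem, speedMeasure, ae_withDensity_iff measurable_metricSpeed,
    ae_volume_prod_iff hne]

/-- The random subcurve of length fraction `a γ` of the reparametrization of `γ`. -/
noncomputable def resample (h : X → ℝ≥0∞) (a : C(I, X) → I) (z : I × C(I, X)) : C(I, X) :=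
  subcurve (reparam h z.2) (a z.2) z.1

/-- The law of the random subcurves with uniformly distributed position. -/
noncomputable def resampledPlan (h : X → ℝ≥0∞) (a : C(I, X) → I) (η : Measure C(I, X)) :
    Measure C(I, X) :=
  ((volume : Measure I).prod η).map (resample h a)

variable {a : C(I, X) → I}

lemma measurable_resample (hh : Measurable h) (hle : ∀ x, h x ≤ 1) (h0 : ∀ x, h x ≠ 0)
    (ha : Measurable a) : Measurable (resample h a) := by
  refine measurable_curve_of_eval fun t => ?_
  have h1 : Measurable fun z : I × C(I, X) => subinterval (a z.2) z.1 t :=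
    continuous_subinterval.measurable.comp
      ((ha.comp measurable_snd).prodMk (measurable_fst.prodMk measurable_const))
  have h2 : Measurable fun z : I × C(I, X) => reparam h z.2 :=
    (measurable_reparam hh hle h0).comp measurable_snd
  exact continuous_evalCurve.measurable.comp (h1.prodMk h2)

instance [IsFiniteMeasure η] : IsFiniteMeasure (resampledPlan h a η) := by
  unfold resampledPlan
  infer_instance

lemma ae_resampledPlan_iff [IsFiniteMeasure η] (hh : Measurable h) (hle : ∀ x, h x ≤ 1)
    (h0 : ∀ x, h x ≠ 0) (ha : Measurable a) {Q : C(I, X) → Prop} (hQ : MeasurableSet {γ | Q γ}) :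
    (∀ᵐ γ ∂(resampledPlan h a η), Q γ) ↔
      ∀ᵐ γ ∂η, ∀ᵐ s : I, Q (subcurve (reparam h γ) (a γ) s) := by
  have hm := measurable_resample hh hle h0 ha
  rw [resampledPlan, ae_map_iff hm.aemeasurable hQ, 
    ae_volume_prod_iff (P := fun z => Q (resample h a z)) (hm hQ)]
  rfl

lemma ae_prod_resampledPlan_iff [IsFiniteMeasure η] (hh : Measurable h) (hle : ∀ x, h x ≤ 1)
    (h0 : ∀ x, h x ≠ 0) (ha : Measurable a) {P : I × C(I, X) → Prop}
    (hP : MeasurableSet {z | P z}) :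
    (∀ᵐ z ∂((volume : Measure I).prod (resampledPlan h a η)), P z) ↔
      ∀ᵐ γ ∂η, ∀ᵐ s : I, ∀ᵐ t : I, P (t, subcurve (reparam h γ) (a γ) s) := by
  rw [ae_volume_prod_iff hP, ae_resampledPlan_iff hh hle h0 ha (measurableSet_ae_volume hP)]

lemma lintegral_resampledPlan [SFinite η] (hh : Measurable h) (hle : ∀ x, h x ≤ 1)
    (h0 : ∀ x, h x ≠ 0) (ha : Measurable a) {G : C(I, X) → ℝ≥0∞} (hG : Measurable G) :
    ∫⁻ γ, G γ ∂(resampledPlan h a η) =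
      ∫⁻ γ, (∫⁻ s : I, G (subcurve (reparam h γ) (a γ) s)) ∂η := by
  have hm := measurable_resample hh hle h0 ha
  rw [resampledPlan, lintegral_map hG hm,
    lintegral_prod_symm' (fun z => G (resample h a z)) (hG.comp hm)]
  rfl

/-- Subcurves of absolutely continuous curves are absolutely continuous. -/
lemma isACCurve_subcurve {γ : C(I, X)} (hγ : IsACCurve γ) {a : I} (ha : 0 < a) (s : I) :
    IsACCurve (subcurve γ a s) := by
  have ha' : (0 : ℝ) < a := ha
  have hms := measurable_metricSpeed_curve γ
  have hmsub : Measurable fun t => metricSpeed γ (subinterval a s t) :=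
    hms.comp (continuous_subinterval_right a s).measurable
  refine isACCurve_of_edist_le
    (w := fun t => ENNReal.ofReal a * metricSpeed γ (subinterval a s t)) (hmsub.const_mul _) ?_ ?_
  · rw [lintegral_const_mul _ hmsub]
    exact ((lintegral_subinterval_le a s ha _).trans_lt hγ.lintegral_metricSpeed_lt_top).ne
  · intro t t' htt
    have hiff : ∀ x y : I, subinterval a s x ≤ subinterval a s y ↔ x ≤ y := by
      intro x y
      rw [← Subtype.coe_le_coe, coe_subinterval, coe_subinterval, ← Subtype.coe_le_coe]
      constructor
      · intro hxy
        exact le_of_mul_le_mul_left (by linarith) ha'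
      · intro hxy
        have := mul_le_mul_of_nonneg_left hxy ha'.le
        linarith
    rw [subcurve_apply, subcurve_apply, lintegral_const_mul _ hmsub,
      ← lintegral_indicator measurableSet_Icc]
    refine (hγ.edist_le ((hiff t t').2 htt)).trans_eq ?_
    have h1 := lintegral_subinterval a s ha
      ((Icc (subinterval a s t) (subinterval a s t')).indicator (metricSpeed γ))
    have h2 : (fun x => (Icc (subinterval a s t) (subinterval a s t')).indicator (metricSpeed γ)
        (subinterval a s x)) =
        (Icc t t').indicator fun x => metricSpeed γ (subinterval a s x) := by
      ext x
      by_cases hx : x ∈ Icc t t'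
      · have hx' : subinterval a s x ∈ Icc (subinterval a s t) (subinterval a s t') :=
          ⟨(hiff _ _).2 hx.1, (hiff _ _).2 hx.2⟩
        rw [indicator_of_mem hx, indicator_of_mem hx']
      · have hx' : subinterval a s x ∉ Icc (subinterval a s t) (subinterval a s t') :=
          fun h' => hx ⟨(hiff _ _).1 h'.1, (hiff _ _).1 h'.2⟩
        rw [indicator_of_notMem hx, indicator_of_notMem hx']
    rw [h2] at h1
    rw [h1, lintegral_indicator measurableSet_Icc, Measure.restrict_restrict measurableSet_Icc]
    congr 2
    refine (inter_eq_left.2 fun x hx => ?_).symm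
    have h3 : (subinterval a s t : ℝ) ≤ x := hx.1
    have h4 : (x : ℝ) ≤ subinterval a s t' := hx.2
    rw [coe_subinterval] at h3 h4
    have h5 := mul_nonneg ha'.le t.2.1
    have h6 := mul_le_mul_of_nonneg_left t'.2.2 ha'.le
    exact ⟨by linarith, by linarith⟩

lemma metricSpeed_subcurve_reparam (hh : Measurable h) (hle : ∀ x, h x ≤ 1) (h0 : ∀ x, h x ≠ 0)
    {γ : C(I, X)} (hγ : γ ∈ properCurves h) {a : I} (ha : 0 < a) (s : I) :
    ∀ᵐ t, metricSpeed (subcurve (reparam h γ) a s) t =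
      ENNReal.ofReal a * (weightedLength h γ / h (subcurve (reparam h γ) a s t)) := by
  filter_upwards [ae_unitInterval_mem_Ioo,
    ae_subinterval ha s (metricSpeed_reparam hh hle h0 hγ)] with t ht ht'
  rw [metricSpeed_subcurve _ ha s ht, ht', subcurve_apply]

lemma weightedLength_subcurve_le (g : X → ℝ≥0∞) (γ : C(I, X)) {a : I} (ha : 0 < a) (s : I) :
    weightedLength g (subcurve γ a s) ≤ weightedLength g γ := by
  have h1 : weightedLength g (subcurve γ a s) =
      ∫⁻ t, ENNReal.ofReal a * weightedSpeed g γ (subinterval a s t) := by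
    refine lintegral_congr_ae ?_
    filter_upwards [ae_unitInterval_mem_Ioo] with t ht
    rw [weightedSpeed, metricSpeed_subcurve _ ha s ht, subcurve_apply, weightedSpeed]
    ring
  rw [h1, lintegral_const_mul' _ _ ENNReal.ofReal_ne_top]
  exact lintegral_subinterval_le a s ha _

/-- Line integrals are invariant under reparametrization; the factor `1/h` in the new speed cancels
the density `h` of the new time. -/
lemma weightedLength_reparam (hh : Measurable h) (hle : ∀ x, h x ≤ 1) (h0 : ∀ x, h x ≠ 0)
    {γ : C(I, X)} (hγ : γ ∈ properCurves h) {g : X → ℝ≥0∞} (hg : Measurable g) :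
    weightedLength g (reparam h γ) = weightedLength g γ := by
  have hhtop : ∀ x, h x ≠ ∞ := fun x => ne_top_of_le_ne_top ENNReal.one_ne_top (hle x)
  have hm : Measurable fun x => g x / h x := hg.div hh
  have h1 : weightedLength g (reparam h γ) =
      ∫⁻ v, weightedLength h γ * (g (reparam h γ v) / h (reparam h γ v)) := by
    refine lintegral_congr_ae ?_
    filter_upwards [metricSpeed_reparam hh hle h0 hγ] with v hv
    rw [weightedSpeed, hv]
    simp only [div_eq_mul_inv]
    ring
  rw [h1, lintegral_const_mul' _ _ (weightedLength_ne_top hle hγ.1),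
    lintegral_reparam (g := fun x => g x / h x) hh hle h0 hγ hm]
  refine lintegral_congr fun r => ?_
  rw [weightedSpeed, weightedSpeed, mul_right_comm, ENNReal.mul_div_cancel (h0 _) (hhtop _)]

lemma barycenter_resampledPlan_le [IsFiniteMeasure η] (hh : Measurable h) (hle : ∀ x, h x ≤ 1)
    (h0 : ∀ x, h x ≠ 0) (ha : Measurable a) (ha0 : ∀ γ, 0 < a γ)
    (hη : ∀ᵐ γ ∂η, γ ∈ properCurves h) : barycenter (resampledPlan h a η) ≤ barycenter η := by
  refine Measure.le_iff.2 fun s hs => ?_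
  have hg : Measurable (s.indicator (1 : X → ℝ≥0∞)) := measurable_one.indicator hs
  rw [← lintegral_indicator_one hs, ← lintegral_indicator_one hs, lintegral_barycenter _ hg,
    lintegral_barycenter _ hg, lintegral_resampledPlan hh hle h0 ha (measurable_weightedLength hg)]
  refine lintegral_mono_ae ?_
  filter_upwards [hη] with γ hγ
  calc ∫⁻ t : I, weightedLength (s.indicator 1) (subcurve (reparam h γ) (a γ) t)
      ≤ ∫⁻ _ : I, weightedLength (s.indicator 1) γ := lintegral_mono fun t =>
        (weightedLength_subcurve_le _ _ (ha0 γ) t).trans_eq (weightedLength_reparam hh hle h0 hγ hg)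
    _ = _ := by simp

lemma ae_isACCurve_resampledPlan [IsFiniteMeasure η] (hh : Measurable h) (hle : ∀ x, h x ≤ 1)
    (h0 : ∀ x, h x ≠ 0) (ha : Measurable a) (ha0 : ∀ γ, 0 < a γ)
    (hη : ∀ᵐ γ ∂η, γ ∈ properCurves h) : ∀ᵐ γ ∂(resampledPlan h a η), IsACCurve γ := by
  rw [ae_resampledPlan_iff hh hle h0 ha measurableSet_isACCurve]
  filter_upwards [hη] with γ hγ
  exact Eventually.of_forall fun s =>
    isACCurve_subcurve (isACCurve_reparam hh hle h0 hγ) (ha0 γ) s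

lemma ae_metricSpeed_ne_zero_resampledPlan [IsFiniteMeasure η] (hh : Measurable h)
    (hle : ∀ x, h x ≤ 1)
    (h0 : ∀ x, h x ≠ 0) (ha : Measurable a) (ha0 : ∀ γ, 0 < a γ)
    (hη : ∀ᵐ γ ∂η, γ ∈ properCurves h) :
    ∀ᵐ z ∂((volume : Measure I).prod (resampledPlan h a η)), metricSpeed z.2 z.1 ≠ 0 := by
  have hm : MeasurableSet {z : I × C(I, X) | metricSpeed z.2 z.1 ≠ 0} :=
    measurable_metricSpeed (measurableSet_singleton 0).compl
  rw [ae_prod_resampledPlan_iff hh hle h0 ha hm]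
  filter_upwards [hη] with γ hγ
  refine Eventually.of_forall fun s => ?_
  filter_upwards [metricSpeed_subcurve_reparam hh hle h0 hγ (ha0 γ) s] with t ht
  rw [ht]
  have ha' : (0 : ℝ) < a γ := ha0 γ
  refine mul_ne_zero (by simpa using ha') (ENNReal.div_ne_zero.2 ⟨hγ.2, ?_⟩)
  exact ne_top_of_le_ne_top ENNReal.one_ne_top (hle _)

/-- The metric speed of the resampled curves is at most the inverse of the weight, if the length
fraction is at most the inverse of the weighted length. -/
lemma ae_metricSpeed_le_resampledPlan [IsFiniteMeasure η] (hh : Measurable h)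
    (hle : ∀ x, h x ≤ 1)
    (h0 : ∀ x, h x ≠ 0) (ha : Measurable a) (ha0 : ∀ γ, 0 < a γ)
    (ha1 : ∀ γ ∈ properCurves h, ENNReal.ofReal (a γ) * weightedLength h γ ≤ 1)
    (hη : ∀ᵐ γ ∂η, γ ∈ properCurves h) :
    ∀ᵐ γ ∂(resampledPlan h a η), ∀ᵐ t : I, metricSpeed γ t ≤ (h (γ t))⁻¹ := by
  have hm : MeasurableSet {z : I × C(I, X) | metricSpeed z.2 z.1 ≤ (h (evalCurve z))⁻¹} :=
    measurableSet_le measurable_metricSpeed (hh.comp continuous_evalCurve.measurable).inv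
  refine (ae_resampledPlan_iff (Q := fun γ => ∀ᵐ t : I, metricSpeed γ t ≤ (h (γ t))⁻¹) hh hle h0 ha
    (measurableSet_ae_volume hm)).2 ?_
  filter_upwards [hη] with γ hγ
  refine Eventually.of_forall fun s => ?_
  filter_upwards [metricSpeed_subcurve_reparam hh hle h0 hγ (ha0 γ) s] with t ht
  rw [ht, div_eq_mul_inv, ← mul_assoc]
  exact mul_le_of_le_one_left' (ha1 γ hγ)

/-- This is the compression estimate. The weight `c`, bounded by the weighted length, compensates
the normalization of time, and the uniform position of the subcurve turns a fixed time into an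
average over time. -/
lemma lintegral_eval_resampledPlan_le {c : C(I, X) → ℝ≥0∞} (hc : Measurable c)
    (hcle : ∀ γ, c γ ≤ weightedLength h γ) (hcp : ∀ γ, c γ ≠ 0 → γ ∈ properCurves h)
    [IsFiniteMeasure η] [IsFiniteMeasure (η.withDensity c)]
    (hh : Measurable h) (hle : ∀ x, h x ≤ 1)
    (h0 : ∀ x, h x ≠ 0) (ha : Measurable a) (ha2 : ∀ γ, (a γ : ℝ) ≤ 1 / 2) {g : X → ℝ≥0∞}
    (hg : Measurable g) (t : I) :
    ∫⁻ γ, g (γ t) ∂(resampledPlan h a (η.withDensity c)) ≤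
      2 * ∫⁻ x, h x * g x ∂(barycenter η) := by
  have hgt : Measurable fun γ : C(I, X) => g (γ t) :=
    hg.comp (Continuous.measurable (by fun_prop))
  rw [lintegral_resampledPlan hh hle h0 ha hgt, lintegral_barycenter (g := fun x => h x * g x) η (hh.mul hg),
    ← lintegral_const_mul' _ _ ENNReal.ofNat_ne_top]
  have hm : Measurable fun γ : C(I, X) => ∫⁻ s : I, g (subcurve (reparam h γ) (a γ) s t) := by
    have := hgt.comp (measurable_resample hh hle h0 ha)
    exact Measurable.lintegral_prod_left' (f := fun z : I × C(I, X) => g (resample h a z t)) this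
  rw [lintegral_withDensity_eq_lintegral_mul _ hc hm]
  refine lintegral_mono fun γ => ?_
  rw [Pi.mul_apply]
  by_cases hcγ : c γ = 0
  · rw [hcγ, zero_mul]
    exact zero_le
  have hγ := hcp γ hcγ
  have hσ : (0 : ℝ) < (σ (a γ) : I) := by
    rw [unitInterval.coe_symm_eq]
    linarith [ha2 γ]
  have h1 : ENNReal.ofReal (σ (a γ) : I) * ∫⁻ s : I, g (subcurve (reparam h γ) (a γ) s t) ≤
      ∫⁻ v, g (reparam h γ v) := by
    simp only [subcurve_apply, ← subinterval_symm (a γ) _ t]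
    exact lintegral_subinterval_le (σ (a γ)) t hσ fun v => g (reparam h γ v)
  -- The constant `2` bounds `1/(1 - a)`, as `a ≤ 1/2`.
  have h2 : ∫⁻ s : I, g (subcurve (reparam h γ) (a γ) s t) ≤ 2 * ∫⁻ v, g (reparam h γ v) := by
    have h3 : (1 : ℝ≥0∞) ≤ 2 * ENNReal.ofReal (σ (a γ) : I) := by
      rw [← ENNReal.ofReal_ofNat, ← ENNReal.ofReal_mul (by norm_num), ← ENNReal.ofReal_one]
      refine ENNReal.ofReal_le_ofReal ?_
      rw [unitInterval.coe_symm_eq]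
      linarith [ha2 γ]
    calc _ = 1 * ∫⁻ s : I, g (subcurve (reparam h γ) (a γ) s t) := (one_mul _).symm
      _ ≤ 2 * ENNReal.ofReal (σ (a γ) : I) *
          ∫⁻ s : I, g (subcurve (reparam h γ) (a γ) s t) := by gcongr
      _ ≤ _ := by
        rw [mul_assoc]
        gcongr
  calc c γ * ∫⁻ s : I, g (subcurve (reparam h γ) (a γ) s t)
      ≤ weightedLength h γ * (2 * ∫⁻ v, g (reparam h γ v)) := by
        gcongr
        exact hcle γ
    _ = 2 * (weightedLength h γ * ∫⁻ v, g (reparam h γ v)) := by ring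
    _ = 2 * weightedLength (fun x => h x * g x) γ := by
        rw [lintegral_reparam hh hle h0 hγ hg]
        congr 1
        refine lintegral_congr fun r => ?_
        simp only [weightedSpeed]
        ring

end ResampledPlan

/-! ### Null sets and normalized derivatives of the resampled plan -/

section Comparison

variable {X : Type*} [MetricSpace X] [SecondCountableTopology X] [MeasurableSpace X]
  [BorelSpace X] {μ : Measure X} {η : Measure C(I, X)} {h : X → ℝ≥0∞}

/-- The primitive of the weighted speed is differentiable on a Borel set of full measure. -/
lemma exists_measurableSet_tendsto_slope (hh : Measurable h) (hle : ∀ x, h x ≤ 1) :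
    ∃ S : Set (I × C(I, X)), MeasurableSet S ∧
      (∀ z ∈ S, Tendsto (fun s : I => (primitive (weightedSpeed h z.2) s -
        primitive (weightedSpeed h z.2) z.1) / ((s : ℝ) - z.1)) (𝓝[≠] z.1)
        (𝓝 (weightedSpeed h z.2 z.1).toReal) ∧ weightedSpeed h z.2 z.1 ≠ ∞) ∧
      ∀ γ ∈ properCurves h, ∀ᵐ r : I, (r, γ) ∈ S := by
  classical
  obtain ⟨G, hGdef⟩ : ∃ G : Set C(I, X), G = properCurves h := ⟨_, rfl⟩
  have hG : MeasurableSet G := hGdef ▸ measurableSet_properCurves hh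
  have hGc : ∀ γ ∈ G, Continuous (primitive (weightedSpeed h γ)) := fun γ hγ =>
    continuous_primitive (measurable_weightedSpeed hh γ)
      (weightedLength_ne_top hle (hGdef ▸ hγ : γ ∈ properCurves h).1)
  set J : C(I, X) → C(I, ℝ) := fun γ => if hγ : γ ∈ G then ⟨_, hGc γ hγ⟩ else 0 with hJdef
  have hJ : Measurable J := by
    refine measurable_curve_of_eval fun t => ?_
    have h1 : (fun γ => J γ t) = fun γ => if γ ∈ G then primitive (weightedSpeed h γ) t else 0 := by
      ext γ
      by_cases hγ : γ ∈ G
      · simp [hJdef, hγ]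
      · simp [hJdef, hγ]
    rw [h1]
    refine Measurable.ite hG ?_ measurable_const
    have h2 : Measurable fun γ : C(I, X) => (γ, t) := measurable_prodMk_right
    simpa [Function.comp_def] using
      (measurable_primitive_param (measurable_weightedSpeed_param hh)).comp h2
  have hpair : Measurable fun z : I × C(I, X) => (J z.2, (z.1 : ℝ)) :=
    (hJ.comp measurable_snd).prodMk (measurable_subtype_coe.comp measurable_fst)
  have hcont : Continuous
      (Function.uncurry fun g : C(I, ℝ) => IccExtend (zero_le_one' ℝ) g) := by
    have : Continuous fun z : C(I, ℝ) × ℝ => z.1 (projIcc 0 1 (zero_le_one' ℝ) z.2) :=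
      ContinuousEval.continuous_eval.comp (f := fun z : C(I, ℝ) × ℝ =>
        (z.1, projIcc 0 1 (zero_le_one' ℝ) z.2))
        (continuous_fst.prodMk (continuous_projIcc.comp continuous_snd))
    exact this
  have hw : Measurable fun z : I × C(I, X) => weightedSpeed h z.2 z.1 := by
    simpa [Function.comp_def] using (measurable_weightedSpeed_param hh).comp measurable_swap
  have hderiv : Measurable fun z : I × C(I, X) =>
      deriv (IccExtend (zero_le_one' ℝ) (J z.2)) (z.1 : ℝ) := by
    simpa [Function.comp_def] using measurable_deriv_IccExtend.comp hpair
  refine ⟨Prod.snd ⁻¹' G ∩ {z | (z.1 : ℝ) ∈ Ioo (0 : ℝ) 1} ∩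
    {z | DifferentiableAt ℝ (IccExtend (zero_le_one' ℝ) (J z.2)) (z.1 : ℝ)} ∩
    {z | deriv (IccExtend (zero_le_one' ℝ) (J z.2)) (z.1 : ℝ) =
      (weightedSpeed h z.2 z.1).toReal} ∩ {z | weightedSpeed h z.2 z.1 ≠ ∞}, ?_, ?_, ?_⟩
  · refine ((((measurable_snd hG).inter ?_).inter ?_).inter ?_).inter ?_
    · exact (measurable_subtype_coe.comp measurable_fst) measurableSet_Ioo
    · exact hpair (measurableSet_of_differentiableAt_with_param ℝ hcont)
    · exact measurableSet_eq_fun hderiv hw.ennreal_toReal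
    · exact hw (measurableSet_singleton ∞).compl
  · rintro ⟨r, γ⟩ ⟨⟨⟨⟨hγ, hr⟩, hd⟩, he⟩, ht⟩
    refine ⟨?_, ht⟩
    have h1 : HasDerivWithinAt (IccExtend (zero_le_one' ℝ) (J γ))
        (weightedSpeed h γ r).toReal (Icc 0 1) (r : ℝ) := by
      have := hd.hasDerivAt.hasDerivWithinAt (s := Icc (0 : ℝ) 1)
      rwa [show deriv _ _ = _ from he] at this
    have h2 := hasDerivWithinAt_IccExtend_iff.1 h1
    have h3 : ∀ s, J γ s = primitive (weightedSpeed h γ) s := by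
      intro s
      simp only [hJdef, dif_pos (show γ ∈ G from hγ)]
      rfl
    simpa only [h3] using h2
  · intro γ hγ
    have hγ' : γ ∈ G := hGdef ▸ hγ
    have hfin := weightedLength_ne_top hle hγ.1
    have hJγ : (J γ : I → ℝ) = primitive (weightedSpeed h γ) := by
      ext s
      simp only [hJdef, dif_pos hγ']
      rfl
    filter_upwards [tendsto_slope_primitive (measurable_weightedSpeed hh γ) hfin,
      ae_unitInterval_mem_Ioo, ae_lt_top (measurable_weightedSpeed hh γ) hfin] with r hr hr1 hr2
    have h1 := (hasDerivWithinAt_IccExtend_iff.2 hr).hasDerivAt (Icc_mem_nhds hr1.1 hr1.2)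
    rw [← hJγ] at h1
    exact ⟨⟨⟨⟨hγ', hr1⟩, h1.differentiableAt⟩, h1.deriv⟩, hr2.ne⟩

lemma measurable_reparam_pair (hh : Measurable h) (hle : ∀ x, h x ≤ 1) (h0 : ∀ x, h x ≠ 0) :
    Measurable fun z : I × C(I, X) =>
      (normalizedPrimitive (weightedSpeed h z.2) z.1, reparam h z.2) := by
  refine Measurable.prodMk ?_ ((measurable_reparam hh hle h0).comp measurable_snd)
  simpa [Function.comp_def] using
    (measurable_normalizedPrimitive_weightedSpeed hh).comp measurable_swap

variable {c : C(I, X) → ℝ≥0∞}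

lemma weightedSpeed_ne_zero_iff (h0 : ∀ x, h x ≠ 0) (γ : C(I, X)) (r : I) :
    weightedSpeed h γ r ≠ 0 ↔ metricSpeed γ r ≠ 0 := by
  simp [weightedSpeed, h0]

lemma ae_metricSpeed_eq_zero_of_notMem_properCurves (hh : Measurable h) (h0 : ∀ x, h x ≠ 0)
    {γ : C(I, X)} (hγ : IsACCurve γ) (hγ' : γ ∉ properCurves h) :
    ∀ᵐ r : I, metricSpeed γ r = 0 := by
  have h1 : weightedLength h γ = 0 := by
    by_contra h2
    exact hγ' ⟨hγ, h2⟩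
  rw [weightedLength, lintegral_eq_zero_iff (measurable_weightedSpeed hh γ)] at h1
  filter_upwards [h1] with r hr
  by_contra h2
  exact (weightedSpeed_ne_zero_iff h0 γ r).2 h2 hr

/-- Almost all properties of the reparametrized curves transfer to the original plan. -/
lemma ae_ae_reparam_iff (hh : Measurable h) (hle : ∀ x, h x ≤ 1) (h0 : ∀ x, h x ≠ 0)
    (hac : ∀ᵐ γ ∂η, IsACCurve γ) (hc : Measurable c) (hcp : ∀ γ, c γ ≠ 0 ↔ γ ∈ properCurves h)
    {P : I × C(I, X) → Prop} (hP : MeasurableSet {z | P z}) :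
    (∀ᵐ γ ∂(η.withDensity c), ∀ᵐ v : I, P (v, reparam h γ)) ↔
      ∀ᵐ γ ∂η, ∀ᵐ r : I, metricSpeed γ r ≠ 0 →
        P (normalizedPrimitive (weightedSpeed h γ) r, reparam h γ) := by
  rw [ae_withDensity_iff hc]
  constructor
  · intro H
    filter_upwards [H, hac] with γ hγ hγac
    by_cases hp : γ ∈ properCurves h
    · filter_upwards [ae_normalizedPrimitive (measurable_weightedSpeed hh γ)
        (weightedLength_ne_top hle hγac) hp.2 (hγ ((hcp γ).2 hp))] with r hr hr0
      exact hr ((weightedSpeed_ne_zero_iff h0 γ r).2 hr0)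
    · filter_upwards [ae_metricSpeed_eq_zero_of_notMem_properCurves hh h0 hγac hp] with r hr hr0
      exact absurd hr hr0
  · intro H
    filter_upwards [H, hac] with γ hγ hγac hcγ
    have hp := (hcp γ).1 hcγ
    have hPm : MeasurableSet {v : I | P (v, reparam h γ)} := measurable_prodMk_right hP
    refine ae_of_ae_normalizedPrimitive (measurable_weightedSpeed hh γ)
      (weightedLength_ne_top hle hγac) hp.2 hPm ?_
    filter_upwards [hγ] with r hr hr0
    exact hr ((weightedSpeed_ne_zero_iff h0 γ r).1 hr0)

/-- Null sets of a plan, in terms of the reparametrized curves. -/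
lemma speedMeasure_eq_zero_iff_reparam [IsFiniteMeasure η] (hh : Measurable h)
    (hle : ∀ x, h x ≤ 1) (h0 : ∀ x, h x ≠ 0) (hac : ∀ᵐ γ ∂η, IsACCurve γ) (hc : Measurable c)
    (hcp : ∀ γ, c γ ≠ 0 ↔ γ ∈ properCurves h) {S S₁ : Set (I × C(I, X))}
    (hS : MeasurableSet S) (hS₁ : MeasurableSet S₁)
    (hiff : ∀ γ ∈ properCurves h, ∀ r : I, (r, γ) ∈ S ↔
      (normalizedPrimitive (weightedSpeed h γ) r, reparam h γ) ∈ S₁) :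
    speedMeasure η S = 0 ↔
      ∀ᵐ γ ∂(η.withDensity c), ∀ᵐ v : I, (v, reparam h γ) ∉ S₁ := by
  rw [speedMeasure_eq_zero_iff hS,
    ae_ae_reparam_iff (P := fun z => z ∉ S₁) hh hle h0 hac hc hcp hS₁.compl]
  refine eventually_congr ?_
  filter_upwards [hac] with γ hγ
  by_cases hp : γ ∈ properCurves h
  · simp only [hiff γ hp]
  · refine eventually_congr ?_
    filter_upwards [ae_metricSpeed_eq_zero_of_notMem_properCurves hh h0 hγ hp] with r hr
    simp [hr]

variable {a : C(I, X) → I}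

/-- Null sets of a resampled plan, in terms of the reparametrized curves. -/
lemma speedMeasure_resampledPlan_eq_zero_iff [IsFiniteMeasure η] (hh : Measurable h)
    (hle : ∀ x, h x ≤ 1) (h0 : ∀ x, h x ≠ 0) (ha : Measurable a) (ha0 : ∀ γ, 0 < a γ)
    (hη : ∀ᵐ γ ∂η, γ ∈ properCurves h) {S S₁ : Set (I × C(I, X))}
    (hS : MeasurableSet S) (hS₁ : MeasurableSet S₁)
    (hiff : ∀ᵐ γ ∂η, ∀ᵐ s : I, ∀ᵐ t : I, ((t, subcurve (reparam h γ) (a γ) s) ∈ S ↔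
      (subinterval (a γ) s t, reparam h γ) ∈ S₁)) :
    speedMeasure (resampledPlan h a η) S = 0 ↔
      ∀ᵐ γ ∂η, ∀ᵐ v : I, (v, reparam h γ) ∉ S₁ := by
  have h1 : speedMeasure (resampledPlan h a η) S = 0 ↔
      ∀ᵐ γ ∂η, ∀ᵐ s : I, ∀ᵐ t : I, (t, subcurve (reparam h γ) (a γ) s) ∉ S := by
    rw [← ae_prod_resampledPlan_iff (P := fun z => z ∉ S) hh hle h0 ha hS.compl,
      measure_eq_zero_iff_ae_notMem, speedMeasure, ae_withDensity_iff measurable_metricSpeed]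
    refine eventually_congr ?_
    filter_upwards [ae_metricSpeed_ne_zero_resampledPlan hh hle h0 ha ha0 hη] with z hz
    simp [hz]
  rw [h1]
  refine eventually_congr ?_
  filter_upwards [hiff] with γ hγ
  have hm : MeasurableSet {v : I | (v, reparam h γ) ∉ S₁} := measurable_prodMk_right hS₁.compl
  constructor
  · intro H
    refine ae_of_ae_subinterval (ha0 γ) hm ?_
    filter_upwards [H, hγ] with s hs hs'
    filter_upwards [hs, hs'] with t ht ht'
    exact fun h2 => ht (ht'.2 h2)
  · intro H
    filter_upwards [hγ] with s hs
    filter_upwards [hs, ae_subinterval (ha0 γ) s H] with t ht ht'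
    exact fun h2 => ht' (ht.1 h2)

end Comparison

/-! ### Comparison of normalized derivatives along the two plans -/

section ComparisonDeriv

variable {X : Type*} [MetricSpace X] [SecondCountableTopology X] [MeasurableSpace X]
  [BorelSpace X] {μ : Measure X} {η : Measure C(I, X)} {h : X → ℝ≥0∞} {a : C(I, X) → I}
  {p q : ℝ≥0∞} {ρ : X → ℝ≥0∞} {f : X → ℝ} {c : C(I, X) → ℝ≥0∞}

lemma aemeasurable_normalizedDeriv_resampledPlan [IsFiniteMeasure η] (hh : Measurable h)
    (hle : ∀ x, h x ≤ 1) (h0 : ∀ x, h x ≠ 0) (ha : Measurable a) (ha0 : ∀ γ, 0 < a γ)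
    (hη : ∀ᵐ γ ∂η, γ ∈ properCurves h) (hpq : p.HolderConjugate q) (hρ : Measurable ρ)
    (hρq : eLpNorm ρ q μ < ∞) (hbar : barycenter η ≤ μ.withDensity ρ)
    (hf : MemNewtonSobolev p μ f) :
    AEMeasurable (normalizedDeriv f) ((volume : Measure I).prod (resampledPlan h a η)) :=
  aemeasurable_normalizedDeriv (ae_isACCurve_resampledPlan hh hle h0 ha ha0 hη)
    (ae_metricSpeed_ne_zero_resampledPlan hh hle h0 ha ha0 hη) hpq hρ hρq
    ((barycenter_resampledPlan_le hh hle h0 ha ha0 hη).trans hbar) hf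

/-- A function that is almost everywhere equal to a measurable function agrees with it outside a
measurable null set. -/
lemma exists_measurable_eq_off_null {Z : Type*} [MeasurableSpace Z] {ν : Measure Z} {F : Z → ℝ}
    (hF : AEMeasurable F ν) : ∃ (F₁ : Z → ℝ) (N : Set Z), Measurable F₁ ∧ MeasurableSet N ∧
      (∀ z, z ∉ N → F z = F₁ z) ∧ ∀ᵐ z ∂ν, z ∉ N := by
  refine ⟨hF.mk F, toMeasurable ν {z | F z ≠ hF.mk F z}, hF.measurable_mk,
    measurableSet_toMeasurable _ _, fun z hz => ?_, ?_⟩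
  · by_contra h
    exact hz (subset_toMeasurable _ _ h)
  · rw [← measure_eq_zero_iff_ae_notMem, measure_toMeasurable]
    exact hF.ae_eq_mk

/-- Resampling with fraction `1` is plain reparametrization, since the only subcurve is the whole
curve; the reparametrized curves have nonzero speed almost everywhere, so measurability is available
for them. -/
lemma exists_measurable_normalizedDeriv_reparam [IsFiniteMeasure η] (hh : Measurable h)
    (hle : ∀ x, h x ≤ 1) (h0 : ∀ x, h x ≠ 0)
    (hη : ∀ᵐ γ ∂η, γ ∈ properCurves h) (hpq : p.HolderConjugate q) (hρ : Measurable ρ)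
    (hρq : eLpNorm ρ q μ < ∞) (hbar : barycenter η ≤ μ.withDensity ρ)
    (hf : MemNewtonSobolev p μ f) :
    ∃ (F₁ : I × C(I, X) → ℝ) (N : Set (I × C(I, X))), Measurable F₁ ∧ MeasurableSet N ∧
      (∀ z, z ∉ N → normalizedDeriv f z = F₁ z) ∧
      ∀ᵐ γ ∂η, ∀ᵐ v : I, (v, reparam h γ) ∉ N := by
  have h1 := aemeasurable_normalizedDeriv_resampledPlan (a := fun _ => 1) hh hle h0
    measurable_const (fun _ => zero_lt_one) hη hpq hρ hρq hbar hf
  obtain ⟨F₁, N, hF₁, hN, hFN, hN0⟩ := exists_measurable_eq_off_null h1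
  refine ⟨F₁, N, hF₁, hN, hFN, ?_⟩
  rw [ae_prod_resampledPlan_iff (P := fun z => z ∉ N) hh hle h0 measurable_const hN.compl] at hN0
  filter_upwards [hN0] with γ hγ
  obtain ⟨s, hs⟩ := hγ.exists
  filter_upwards [hs] with t ht
  have h2 : subcurve (reparam h γ) 1 s = reparam h γ := by
    ext v
    rw [subcurve_apply, subinterval_one]
  rwa [h2] at ht

/-- Curves of the original plan may rest on sets of times of positive measure, where `f ∘ γ` escapes
the control of the barycenter. A measurable version is therefore pulled back from the reparametrized
curves; times of rest are null for the speed measure. -/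
lemma normalizedDeriv_ae_eq_reparam [IsFiniteMeasure η] (hh : Measurable h)
    (hle : ∀ x, h x ≤ 1) (h0 : ∀ x, h x ≠ 0) (hac : ∀ᵐ γ ∂η, IsACCurve γ) (hc : Measurable c)
    (hcp : ∀ γ, c γ ≠ 0 ↔ γ ∈ properCurves h)
    {F₁ : I × C(I, X) → ℝ} {N : Set (I × C(I, X))} (hN : MeasurableSet N)
    (hFN : ∀ z, z ∉ N → normalizedDeriv f z = F₁ z)
    (hN0 : ∀ᵐ γ ∂(η.withDensity c), ∀ᵐ v : I, (v, reparam h γ) ∉ N) :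
    normalizedDeriv f =ᵐ[speedMeasure η]
      fun z => F₁ (normalizedPrimitive (weightedSpeed h z.2) z.1, reparam h z.2) := by
  obtain ⟨S, hS, hSt, hSae⟩ := exists_measurableSet_tendsto_slope (X := X) hh hle
  rw [ae_ae_reparam_iff (P := fun z => z ∉ N) hh hle h0 hac hc hcp hN.compl] at hN0
  obtain ⟨G, hGdef⟩ : ∃ G : Set C(I, X), G = properCurves h := ⟨_, rfl⟩
  have hG : MeasurableSet G := hGdef ▸ measurableSet_properCurves hh
  have hB := measurable_reparam_pair hh hle h0 hN
  have key : speedMeasure η ((S ∩ Prod.snd ⁻¹' G)ᶜ ∪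
      (fun z : I × C(I, X) =>
        (normalizedPrimitive (weightedSpeed h z.2) z.1, reparam h z.2)) ⁻¹' N ∪
      {z | metricSpeed z.2 z.1 = 0}) = 0 := by
    rw [speedMeasure_eq_zero_iff]
    · filter_upwards [hN0, hac] with γ hγ hγac
      by_cases hp : γ ∈ properCurves h
      · filter_upwards [hγ, hSae γ hp] with r hr hr' hr0
        rintro ((h2 | h2) | h2)
        · exact h2 ⟨hr', (hGdef ▸ hp : γ ∈ G)⟩
        · exact hr hr0 h2
        · exact hr0 h2
      · filter_upwards [ae_metricSpeed_eq_zero_of_notMem_properCurves hh h0 hγac hp] with r hr hr0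
        exact absurd hr hr0
    · exact ((hS.inter (measurable_snd hG)).compl.union hB).union
        (measurable_metricSpeed (measurableSet_singleton 0))
  filter_upwards [measure_eq_zero_iff_ae_notMem.1 key] with z hz
  simp only [mem_union, not_or, mem_compl_iff, not_not] at hz
  obtain ⟨⟨⟨hz1, hz2⟩, hz3⟩, hz4⟩ := hz
  have hp : z.2 ∈ properCurves h := hGdef ▸ hz2
  rw [← hFN _ hz3]
  exact normalizedDeriv_reparam hh hle h0 hp f (hSt z hz1).1 (hSt z hz1).2
    ((weightedSpeed_ne_zero_iff h0 z.2 z.1).2 hz4)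

/-- The barycenter of a plan is absolutely continuous with respect to that of its resampling. -/
lemma barycenter_absolutelyContinuous_resampledPlan [IsFiniteMeasure η]
    [IsFiniteMeasure (η.withDensity c)] (hh : Measurable h)
    (hle : ∀ x, h x ≤ 1) (h0 : ∀ x, h x ≠ 0) (hac : ∀ᵐ γ ∂η, IsACCurve γ) (hc : Measurable c)
    (hcp : ∀ γ, c γ ≠ 0 ↔ γ ∈ properCurves h) (hη : ∀ᵐ γ ∂(η.withDensity c), γ ∈ properCurves h)
    (ha : Measurable a) (ha0 : ∀ γ, 0 < a γ) :
    barycenter η ≪ barycenter (resampledPlan h a (η.withDensity c)) := by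
  have he : Measurable (evalCurve : I × C(I, X) → X) := continuous_evalCurve.measurable
  refine Measure.AbsolutelyContinuous.mk fun s hs hs0 => ?_
  rw [barycenter, Measure.map_apply he hs] at hs0 ⊢
  rw [speedMeasure_eq_zero_iff_reparam hh hle h0 hac hc hcp (he hs) (he hs)]
  · rwa [speedMeasure_resampledPlan_eq_zero_iff hh hle h0 ha ha0 hη (he hs) (he hs)] at hs0
    exact Eventually.of_forall fun γ => Eventually.of_forall fun s => Eventually.of_forall
      fun t => Iff.rfl
  · intro γ hγ r
    rw [mem_preimage, mem_preimage, evalCurve, evalCurve, reparam_apply hh hle h0 hγ]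

/-- Essential suprema of normalized derivatives along the curves through a point are preserved by
resampling. -/
lemma ae_eLpNorm_normalizedDeriv_eq [IsFiniteMeasure η]
    [IsFiniteMeasure (η.withDensity c)] (hh : Measurable h)
    (hle : ∀ x, h x ≤ 1) (h0 : ∀ x, h x ≠ 0) (hac : ∀ᵐ γ ∂η, IsACCurve γ) (hc : Measurable c)
    (hcp : ∀ γ, c γ ≠ 0 ↔ γ ∈ properCurves h) (hη : ∀ᵐ γ ∂(η.withDensity c), γ ∈ properCurves h)
    (ha : Measurable a) (ha0 : ∀ γ, 0 < a γ) (hpq : p.HolderConjugate q) (hρ : Measurable ρ)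
    (hρq : eLpNorm ρ q μ < ∞) (hbar : barycenter (η.withDensity c) ≤ μ.withDensity ρ)
    (hf : MemNewtonSobolev p μ f) {κ κ' : Kernel X (I × C(I, X))}
    (hκ : IsDisintegration evalCurve (speedMeasure η) κ)
    (hκ' : IsDisintegration evalCurve
      (speedMeasure (resampledPlan h a (η.withDensity c))) κ') :
    ∀ᵐ x ∂(barycenter η),
      eLpNorm (normalizedDeriv f) ∞ (κ x) = eLpNorm (normalizedDeriv f) ∞ (κ' x) := by
  have he : Measurable (evalCurve : I × C(I, X) → X) := continuous_evalCurve.measurable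
  obtain ⟨F₁, N, hF₁, hN, hFN, hN0⟩ :=
    exists_measurable_normalizedDeriv_reparam hh hle h0 hη hpq hρ hρq hbar hf
  obtain ⟨F₂, N₂, hF₂, hN₂, hFN₂, hN₂0⟩ := exists_measurable_eq_off_null
    (aemeasurable_normalizedDeriv_resampledPlan hh hle h0 ha ha0 hη hpq hρ hρq hbar hf)
  have hFF₂ : normalizedDeriv f
      =ᵐ[speedMeasure (resampledPlan h a (η.withDensity c))] F₂ := by
    refine (withDensity_absolutelyContinuous _ _).ae_le ?_
    filter_upwards [hN₂0] with z hz
    exact hFN₂ z hz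
  rw [ae_prod_resampledPlan_iff (P := fun z => z ∉ N₂) hh hle h0 ha hN₂.compl] at hN₂0
  have hpair := measurable_reparam_pair (X := X) hh hle h0
  have hset : ∀ {F : I × C(I, X) → ℝ}, Measurable F → ∀ c' : ℝ≥0∞,
      MeasurableSet {z | c' < ‖F z‖ₑ} := fun hF c' => measurableSet_lt measurable_const hF.enorm
  refine ae_eLpNorm_top_eq he hκ hκ'
    (barycenter_absolutelyContinuous_resampledPlan hh hle h0 hac hc hcp hη ha ha0)
    (hF₁.comp hpair) hF₂
    (normalizedDeriv_ae_eq_reparam hh hle h0 hac hc hcp hN hFN hN0) hFF₂ fun c' E hE => ?_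
  -- Both null conditions are reduced to the same set of pairs (time, reparametrized curve), so the
  -- equivalence becomes an identity.
  rw [speedMeasure_eq_zero_iff_reparam (S₁ := {z | c' < ‖F₁ z‖ₑ} ∩ evalCurve ⁻¹' E)
      hh hle h0 hac hc hcp ((hset (hF₁.comp hpair) c').inter (he hE))
      ((hset hF₁ c').inter (he hE)),
    speedMeasure_resampledPlan_eq_zero_iff (S₁ := {z | c' < ‖F₁ z‖ₑ} ∩ evalCurve ⁻¹' E)
      hh hle h0 ha ha0 hη ((hset hF₂ c').inter (he hE)) ((hset hF₁ c').inter (he hE))]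
  · filter_upwards [hN0, hN₂0] with γ hγ hγ₂
    filter_upwards [hγ₂] with s hs
    filter_upwards [hs, ae_subinterval (ha0 γ) s hγ, ae_unitInterval_mem_Ioo] with t ht ht' htI
    have h1 : F₂ (t, subcurve (reparam h γ) (a γ) s) =
        F₁ (subinterval (a γ) s t, reparam h γ) := by
      rw [← hFN₂ _ ht, ← hFN _ ht', normalizedDeriv_subcurve f _ (ha0 γ) s htI]
    simp only [mem_inter_iff, Set.mem_ofPred_eq, mem_preimage, evalCurve, h1, subcurve_apply]
  · intro γ hγ r
    simp only [mem_inter_iff, Set.mem_ofPred_eq, mem_preimage, evalCurve, Function.comp_apply,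
      reparam_apply hh hle h0 hγ]

end ComparisonDeriv

/-! ### The test plan associated with a plan -/

/-- A density in `L^q` has a representative that is finite everywhere, and bounded if `q = ∞`. -/
lemma exists_finite_density {X : Type*} [MeasurableSpace X] {μ : Measure X} {q : ℝ≥0∞}
    (hq : q ≠ 0) {ρ : X → ℝ≥0∞} (hρ : Measurable ρ) (hρq : eLpNorm ρ q μ < ∞) :
    ∃ ρ' : X → ℝ≥0∞, Measurable ρ' ∧ ρ' =ᵐ[μ] ρ ∧ (∀ x, ρ' x ≠ ∞) ∧
      (q = ∞ → ∃ M : ℝ≥0, ∀ x, ρ' x ≤ M) := by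
  obtain ⟨B, hB, hBρ, hBt, hBM⟩ : ∃ B : Set X, MeasurableSet B ∧ (∀ᵐ x ∂μ, x ∈ B) ∧
      (∀ x ∈ B, ρ x ≠ ∞) ∧ (q = ∞ → ∃ M : ℝ≥0, ∀ x ∈ B, ρ x ≤ M) := by
    by_cases hqt : q = ∞
    · subst hqt
      rw [eLpNorm_exponent_top] at hρq
      refine ⟨{x | ρ x ≤ eLpNormEssSup ρ μ}, measurableSet_le hρ measurable_const, ?_,
        fun x hx => ne_top_of_le_ne_top hρq.ne hx,
        fun _ => ⟨(eLpNormEssSup ρ μ).toNNReal, fun x hx => ?_⟩⟩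
      · simpa using ae_le_eLpNormEssSup (f := ρ) (μ := μ)
      · rwa [ENNReal.coe_toNNReal hρq.ne]
    · refine ⟨{x | ρ x ≠ ∞}, hρ (measurableSet_singleton ∞).compl, ?_, fun x hx => hx,
        fun h => absurd h hqt⟩
      have h1 := lintegral_rpow_enorm_lt_top_of_eLpNorm_lt_top hq hqt hρq
      simp only [enorm_eq_self] at h1
      filter_upwards [ae_lt_top (hρ.pow_const _) h1.ne] with x hx hx'
      rw [hx', ENNReal.top_rpow_of_pos (ENNReal.toReal_pos hq hqt)] at hx
      exact lt_irrefl _ hx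
  refine ⟨B.indicator ρ, hρ.indicator hB, ?_, fun x => ?_, fun h => ?_⟩
  · filter_upwards [hBρ] with x hx
    exact indicator_of_mem hx _
  · by_cases hx : x ∈ B
    · rw [indicator_of_mem hx]
      exact hBt x hx
    · simp [hx]
  · obtain ⟨M, hM⟩ := hBM h
    refine ⟨M, fun x => ?_⟩
    by_cases hx : x ∈ B
    · rw [indicator_of_mem hx]
      exact hM x hx
    · simp [hx]

section TestPlan

variable {X : Type*} [MetricSpace X] [SecondCountableTopology X] [MeasurableSpace X]
  [BorelSpace X] {μ : Measure X} {η : Measure C(I, X)} {h : X → ℝ≥0∞} {a : C(I, X) → I}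
  {q : ℝ≥0∞} {ρ : X → ℝ≥0∞} {c : C(I, X) → ℝ≥0∞}

lemma barycenter_withDensity_le [SFinite η] (hc : Measurable c) (hc1 : ∀ γ, c γ ≤ 1) :
    barycenter (η.withDensity c) ≤ barycenter η := by
  refine Measure.le_iff.2 fun s hs => ?_
  have hg : Measurable (s.indicator (1 : X → ℝ≥0∞)) := measurable_one.indicator hs
  rw [← lintegral_indicator_one hs, ← lintegral_indicator_one hs, lintegral_barycenter _ hg,
    lintegral_barycenter _ hg,
    lintegral_withDensity_eq_lintegral_mul _ hc (measurable_weightedLength hg)]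
  exact lintegral_mono fun γ => mul_le_of_le_one_left' (hc1 γ)

lemma lipschitzWith_of_ae_metricSpeed_le {γ : C(I, X)} (hγ : IsACCurve γ) {L : ℝ≥0}
    (hL : ∀ᵐ t : I, metricSpeed γ t ≤ L) : LipschitzWith L γ := by
  have key : ∀ s t : I, s ≤ t → edist (γ s) (γ t) ≤ L * edist s t := by
    intro s t hst
    calc edist (γ s) (γ t) ≤ ∫⁻ r in Icc s t, metricSpeed γ r := hγ.edist_le hst
      _ ≤ ∫⁻ _ in Icc s t, (L : ℝ≥0∞) := lintegral_mono_ae (ae_restrict_of_ae hL)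
      _ = L * edist s t := by
        have hst' : (s : ℝ) ≤ t := hst
        rw [setLIntegral_const, unitInterval.volume_Icc, edist_dist, Subtype.dist_eq, dist_comm,
          Real.dist_eq, abs_of_nonneg (sub_nonneg.2 hst')]
  intro s t
  rcases le_total s t with hst | hst
  · exact key s t hst
  · rw [edist_comm, edist_comm s]
    exact key t s hst

/-- The compression bound comes first, from `h ρ ≤ 1`. Applied to `ρ^q` at each time, it bounds the
energy, because the speed is at most `max(1, ρ)` along the curve. -/
lemma isQTestPlan_resampledPlan (hq : q ≠ 0) [IsFiniteMeasure η] [IsFiniteMeasure (η.withDensity c)]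
    (hh : Measurable h) (hle : ∀ x, h x ≤ 1) (h0 : ∀ x, h x ≠ 0) (hc : Measurable c)
    (hcle : ∀ γ, c γ ≤ weightedLength h γ) (hcp : ∀ γ, c γ ≠ 0 ↔ γ ∈ properCurves h)
    (hη : ∀ᵐ γ ∂(η.withDensity c), γ ∈ properCurves h)
    (ha : Measurable a) (ha0 : ∀ γ, 0 < a γ) (ha2 : ∀ γ, (a γ : ℝ) ≤ 1 / 2)
    (ha1 : ∀ γ ∈ properCurves h, ENNReal.ofReal (a γ) * weightedLength h γ ≤ 1)
    (hρ : Measurable ρ) (hρq : eLpNorm ρ q μ < ∞) (hbar : barycenter η = μ.withDensity ρ)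
    (hhρ : ∀ x, h x = (max 1 (ρ x))⁻¹) (hM : q = ∞ → ∃ M : ℝ≥0, ∀ x, ρ x ≤ M) :
    IsQTestPlan q μ (resampledPlan h a (η.withDensity c)) := by
  have hac := ae_isACCurve_resampledPlan hh hle h0 ha ha0 hη
  have hsp := ae_metricSpeed_le_resampledPlan hh hle h0 ha ha0 ha1 hη
  have hinv : ∀ x, (h x)⁻¹ = max 1 (ρ x) := fun x => by rw [hhρ, inv_inv]
  have hρh : ∀ x, ρ x * h x ≤ 1 := fun x => by
    rw [hhρ, ← div_eq_mul_inv]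
    exact ENNReal.div_le_of_le_mul (by rw [one_mul]; exact le_max_right _ _)
  have hcomp : ∀ (g : X → ℝ≥0∞), Measurable g → ∀ t : I,
      ∫⁻ γ, g (γ t) ∂(resampledPlan h a (η.withDensity c)) ≤ 2 * ∫⁻ x, g x ∂μ := by
    intro g hg t
    refine (lintegral_eval_resampledPlan_le hc hcle (fun γ => (hcp γ).1) hh hle h0 ha ha2 hg
      t).trans ?_
    rw [hbar, lintegral_withDensity_eq_lintegral_mul (g := fun x => h x * g x) _ hρ (hh.mul hg)]
    gcongr with x
    rw [Pi.mul_apply, ← mul_assoc]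
    exact mul_le_of_le_one_left' (hρh x)
  refine ⟨⟨inferInstance, hac⟩, fun hqt => ?_, fun hqt => ?_, 2, two_pos, fun t => ?_⟩
  · have hq0 : 0 ≤ q.toReal := ENNReal.toReal_nonneg
    have hρqm : Measurable fun x => ρ x ^ q.toReal := hρ.pow_const _
    have hint : ∫⁻ x, ρ x ^ q.toReal ∂μ < ∞ := by
      have := lintegral_rpow_enorm_lt_top_of_eLpNorm_lt_top hq hqt hρq
      simpa only [enorm_eq_self] using this
    have hm : Measurable fun z : I × C(I, X) => ρ (z.2 z.1) ^ q.toReal :=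
      hρqm.comp continuous_evalCurve.measurable
    calc ∫⁻ γ, (∫⁻ t : I, metricSpeed γ t ^ q.toReal) ∂(resampledPlan h a (η.withDensity c))
        ≤ ∫⁻ γ, (∫⁻ t : I, (1 + ρ (γ t) ^ q.toReal)) ∂(resampledPlan h a (η.withDensity c)) := by
          refine lintegral_mono_ae ?_
          filter_upwards [hsp] with γ hγ
          refine lintegral_mono_ae ?_
          filter_upwards [hγ] with t ht
          rw [hinv] at ht
          refine (ENNReal.rpow_le_rpow ht hq0).trans ?_
          rcases le_total 1 (ρ (γ t)) with h1 | h1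
          · rw [max_eq_right h1]
            exact le_add_self
          · rw [max_eq_left h1, ENNReal.one_rpow]
            exact le_self_add
      _ = ∫⁻ γ, (1 + ∫⁻ t : I, ρ (γ t) ^ q.toReal) ∂(resampledPlan h a (η.withDensity c)) := by
          refine lintegral_congr fun γ => ?_
          rw [lintegral_add_left measurable_const]
          simp
      _ = resampledPlan h a (η.withDensity c) univ +
          ∫⁻ γ, (∫⁻ t : I, ρ (γ t) ^ q.toReal) ∂(resampledPlan h a (η.withDensity c)) := by
          rw [lintegral_add_left measurable_const]
          simp
      _ = resampledPlan h a (η.withDensity c) univ +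
          ∫⁻ t : I, (∫⁻ γ, ρ (γ t) ^ q.toReal ∂(resampledPlan h a (η.withDensity c))) := by
          congr 1
          exact lintegral_lintegral_swap (f := fun (γ : C(I, X)) (t : I) => ρ (γ t) ^ q.toReal)
            (hm.comp measurable_swap).aemeasurable
      _ ≤ resampledPlan h a (η.withDensity c) univ +
          ∫⁻ _ : I, 2 * ∫⁻ x, ρ x ^ q.toReal ∂μ := by
          gcongr with t
          exact hcomp _ hρqm t
      _ < ∞ := by
          rw [lintegral_const, measure_univ (μ := (volume : Measure I)), mul_one]
          exact ENNReal.add_lt_top.2 ⟨measure_lt_top _ _, ENNReal.mul_lt_top (by simp) hint⟩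
  · obtain ⟨M, hM⟩ := hM hqt
    refine ⟨max 1 M, ?_⟩
    filter_upwards [hac, hsp] with γ hγ hγ'
    refine lipschitzWith_of_ae_metricSpeed_le hγ ?_
    filter_upwards [hγ'] with t ht
    rw [hinv] at ht
    refine ht.trans ?_
    rw [ENNReal.coe_max, ENNReal.coe_one]
    exact max_le_max le_rfl (hM _)
  · refine Measure.le_iff.2 fun s hs => ?_
    have hev : Measurable fun γ : C(I, X) => γ t := Continuous.measurable (by fun_prop)
    rw [← lintegral_indicator_one hs, lintegral_map (measurable_one.indicator hs) hev,
      ← lintegral_indicator_one hs, lintegral_smul_measure]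
    exact hcomp _ (measurable_one.indicator hs) t

lemma exists_isDisintegration_speedMeasure [CompleteSpace X] (η : Measure C(I, X))
    [SigmaFinite (barycenter η)] :
    ∃ κ : Kernel X (I × C(I, X)), IsDisintegration evalCurve (speedMeasure η) κ := by
  rcases isEmpty_or_nonempty X with hX | ⟨⟨x⟩⟩
  · exact exists_isDisintegration_of_isEmpty _
  · have : Nonempty (I × C(I, X)) := ⟨(0, ContinuousMap.const I x)⟩
    have : SigmaFinite ((speedMeasure η).map evalCurve) := ‹SigmaFinite (barycenter η)›
    exact exists_isDisintegration continuous_evalCurve.measurable _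

end TestPlan

end CurvePlans

/-! ### Choice of the weights and conclusion -/

theorem mainTheorem8 {X : Type*} [MetricSpace X] [CompleteSpace X] [SecondCountableTopology X]
    [MeasurableSpace X] [BorelSpace X] (μ : Measure X)
    (hμ : ∀ (x : X) (r : ℝ), μ (Metric.ball x r) < ∞)
    (p q : ℝ≥0∞) (hpq : p.HolderConjugate q)
    (η : Measure C(I, X)) (hη : CurvePlans.IsQPlan q μ η) :
    ∃ η' : Measure C(I, X), CurvePlans.IsQTestPlan q μ η' ∧
      CurvePlans.barycenter η ≪ CurvePlans.barycenter η' ∧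
      CurvePlans.barycenter η' ≪ CurvePlans.barycenter η ∧
      (∃ κ : Kernel X (I × C(I, X)),
        CurvePlans.IsDisintegration CurvePlans.evalCurve (CurvePlans.speedMeasure η) κ) ∧
      (∃ κ' : Kernel X (I × C(I, X)),
        CurvePlans.IsDisintegration CurvePlans.evalCurve (CurvePlans.speedMeasure η') κ') ∧
      ∀ κ κ' : Kernel X (I × C(I, X)),
        CurvePlans.IsDisintegration CurvePlans.evalCurve (CurvePlans.speedMeasure η) κ →
        CurvePlans.IsDisintegration CurvePlans.evalCurve (CurvePlans.speedMeasure η') κ' →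
        ∀ f : X → ℝ, CurvePlans.MemNewtonSobolev p μ f →
          ∀ᵐ x ∂(CurvePlans.barycenter η),
            eLpNorm (CurvePlans.normalizedDeriv f) ∞ (κ x) =
              eLpNorm (CurvePlans.normalizedDeriv f) ∞ (κ' x) := by
  classical
  have hq0 : q ≠ 0 := hpq.symm.ne_zero
  have := hη.isPlan.finite
  have hac := hη.isPlan.ae_ac
  obtain ⟨ρ₀, hρ₀, hρ₀q, hbar₀⟩ := hη.density
  obtain ⟨ρ, hρ, hρρ₀, hρt, hM⟩ := CurvePlans.exists_finite_density hq0 hρ₀ hρ₀q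
  have hρq : eLpNorm ρ q μ < ∞ := by rwa [eLpNorm_congr_ae hρρ₀]
  have hbar : CurvePlans.barycenter η = μ.withDensity ρ := by
    rw [hbar₀, withDensity_congr_ae hρρ₀]
  -- The maximum with `1` gives `h ≤ 1`, so that weighted lengths are finite; finiteness of `ρ`
  -- everywhere gives `h > 0`.
  obtain ⟨h, hhρ⟩ : ∃ h : X → ℝ≥0∞, ∀ x, h x = (max 1 (ρ x))⁻¹ := ⟨_, fun _ => rfl⟩
  have hh : Measurable h := by
    rw [funext hhρ]
    exact (measurable_const.max hρ).inv
  have hle : ∀ x, h x ≤ 1 := fun x => by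
    rw [hhρ, ENNReal.inv_le_one]
    exact le_max_left _ _
  have h0 : ∀ x, h x ≠ 0 := fun x => by
    rw [hhρ]
    exact ENNReal.inv_ne_zero.2 (by simp [hρt x])
  -- The bound by `1` keeps the plan finite and its barycenter below the original one, the bound by
  -- the weighted length gives compression, and `c` vanishes exactly off the proper curves, so no
  -- visible curve is lost.
  obtain ⟨c, hcdef⟩ : ∃ c : C(I, X) → ℝ≥0∞, ∀ γ, c γ =
      {γ : C(I, X) | CurvePlans.IsACCurve γ}.indicator
        (fun γ => min 1 (CurvePlans.weightedLength h γ)) γ := ⟨_, fun _ => rfl⟩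
  have hc : Measurable c := by
    rw [funext hcdef]
    exact (measurable_const.min (CurvePlans.measurable_weightedLength hh)).indicator
      CurvePlans.measurableSet_isACCurve
  have hcmin : ∀ γ, c γ ≤ min 1 (CurvePlans.weightedLength h γ) := fun γ => by
    rw [hcdef]
    exact indicator_le_self' (fun _ _ => zero_le) γ
  have hc1 : ∀ γ, c γ ≤ 1 := fun γ => (hcmin γ).trans (min_le_left _ _)
  have hcle : ∀ γ, c γ ≤ CurvePlans.weightedLength h γ := fun γ =>
    (hcmin γ).trans (min_le_right _ _)
  have hcp : ∀ γ, c γ ≠ 0 ↔ γ ∈ CurvePlans.properCurves h := fun γ => by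
    rw [hcdef]
    by_cases hγ : CurvePlans.IsACCurve γ
    · simp [CurvePlans.properCurves, hγ]
    · simp [CurvePlans.properCurves, hγ]
  have : IsFiniteMeasure (η.withDensity c) := by
    refine isFiniteMeasure_withDensity (ne_top_of_le_ne_top (measure_ne_top η univ) ?_)
    calc ∫⁻ γ, c γ ∂η ≤ ∫⁻ _, 1 ∂η := lintegral_mono hc1
      _ = η univ := by simp
  have hηc : ∀ᵐ γ ∂(η.withDensity c), γ ∈ CurvePlans.properCurves h := by
    rw [ae_withDensity_iff hc]
    exact Eventually.of_forall fun γ => (hcp γ).1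
  have hpos : ∀ γ : C(I, X), 0 < 2 + (CurvePlans.weightedLength h γ).toReal := fun γ => by
    positivity
  have hhalf : ∀ γ : C(I, X), (2 + (CurvePlans.weightedLength h γ).toReal)⁻¹ ≤ 1 / 2 := fun γ => by
    rw [one_div]
    exact inv_anti₀ two_pos (le_add_of_nonneg_right ENNReal.toReal_nonneg)
  -- With `T` the weighted length, `1/(2 + T)` is measurable and positive and satisfies both `a ≤
  -- 1/2` and `a T ≤ 1`.
  obtain ⟨a, hadef⟩ : ∃ a : C(I, X) → I, ∀ γ,
      (a γ : ℝ) = (2 + (CurvePlans.weightedLength h γ).toReal)⁻¹ :=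
    ⟨fun γ => ⟨(2 + (CurvePlans.weightedLength h γ).toReal)⁻¹, (inv_pos.2 (hpos γ)).le,
      (hhalf γ).trans (by norm_num)⟩, fun _ => rfl⟩
  have ha : Measurable a := by
    have h1 : Measurable fun γ => (a γ : ℝ) := by
      simp only [hadef]
      exact ((CurvePlans.measurable_weightedLength hh).ennreal_toReal.const_add 2).inv
    exact h1.subtype_mk (h := fun γ => (a γ).2)
  have ha0 : ∀ γ, 0 < a γ := fun γ => by
    rw [← Subtype.coe_lt_coe, hadef]
    exact inv_pos.2 (hpos γ)
  have ha2 : ∀ γ, (a γ : ℝ) ≤ 1 / 2 := fun γ => (hadef γ).le.trans (hhalf γ)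
  have ha1 : ∀ γ ∈ CurvePlans.properCurves h,
      ENNReal.ofReal (a γ) * CurvePlans.weightedLength h γ ≤ 1 := by
    intro γ hγ
    conv_lhs => rw [← ENNReal.ofReal_toReal (CurvePlans.weightedLength_ne_top hle hγ.1)]
    rw [← ENNReal.ofReal_mul (a γ).2.1, hadef, ← ENNReal.ofReal_one]
    refine ENNReal.ofReal_le_ofReal ?_
    rw [inv_mul_le_one₀ (hpos γ)]
    linarith
  have hbarc := CurvePlans.barycenter_withDensity_le (η := η) hc hc1
  have hbar' := (CurvePlans.barycenter_resampledPlan_le hh hle h0 ha ha0 hηc).trans hbarc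
  -- Finiteness on balls enters only here: it makes `μ`, and with it both barycenters, σ-finite,
  -- which the existence of disintegrations requires.
  have : IsLocallyFiniteMeasure μ :=
    ⟨fun x => ⟨Metric.ball x 1, Metric.ball_mem_nhds x one_pos, hμ x 1⟩⟩
  have : SigmaFinite (CurvePlans.barycenter η) := by
    rw [hbar]
    exact SigmaFinite.withDensity_of_ne_top (Eventually.of_forall hρt)
  have : SigmaFinite
      (CurvePlans.barycenter (CurvePlans.resampledPlan h a (η.withDensity c))) :=
    Measure.sigmaFinite_of_le _ hbar'
  exact ⟨CurvePlans.resampledPlan h a (η.withDensity c),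
    CurvePlans.isQTestPlan_resampledPlan hq0 hh hle h0 hc hcle hcp hηc ha ha0 ha2 ha1 hρ hρq hbar
      hhρ hM,
    CurvePlans.barycenter_absolutelyContinuous_resampledPlan hh hle h0 hac hc hcp hηc ha ha0,
    Measure.absolutelyContinuous_of_le hbar',
    CurvePlans.exists_isDisintegration_speedMeasure η,
    CurvePlans.exists_isDisintegration_speedMeasure _,
    fun κ κ' hκ hκ' f hf => CurvePlans.ae_eLpNorm_normalizedDeriv_eq hh hle h0 hac hc hcp hηc ha ha0
      hpq hρ hρq (hbarc.trans hbar.le) hf hκ hκ'⟩
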